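/- Let $k,m,N$ be positive integers with $m$ square-free and let $\chi$ be a Dirichlet character modulo $mN$. Write $\theta^J_{m,r}(\tau,z)=\sum_{n\in\mathbb Z}e^{2\pi i m((n+\frac r{2m})^2\tau+2(n+\frac r{2m})z)}$ and $\theta_{m,r}(\tau)=\theta^J_{m,r}(\tau,0)$ for $\tau\in\mathbb H$, $z\in\mathbb C$, $0\le r<2m$. For $\gamma=\begin{pmatrix}a&b\\c&d\end{pmatrix}\in SL_2(\mathbb Z)$ let $U_1(\gamma)$ be the $2\times 2$ matrix such that $\Theta(\gamma\tau,\tfrac{z}{c\tau+d})=e^{2\pi i\frac{cz^2}{c\tau+d}}(c\tau+d)^{1/2}U_1(\gamma)\Theta(\tau,z)$ (principal square root) for the column vector $\Theta=(\theta^J_{1,0},\theta^J_{1,1})^t$, and for $\gamma\in\Gamma_0(m)$ put $\omega_m(\gamma)=\det U_1\begin{pmatrix}a&mb\\c/m&d\end{pmatrix}$. Let $M_w(\Gamma_0(mN),v)$ and $S_w(\Gamma_0(mN),v)$ be the spaces of modular forms and of cusp forms of weight $w$ on $\Gamma_0(mN)$ with character $v$; $\chi$ is viewed as the character $\gamma\mapsto\chi(d)$.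 Let $J_{k,m}(\Gamma_0(mN),\chi)$ be the space of Jacobi forms $\phi(\tau,z)$ of weight $k$, index $m$ and character $\chi$ for $\Gamma_0(mN)\ltimes\mathbb Z^2$, with theta decomposition $\phi=\sum_{0\le r<2m}h_{m,r}(\tau)\theta^J_{m,r}(\tau,z)$, and let $J^*_{k,m}(\Gamma_0(mN),\chi)^0$ be the subspace of those $\phi$ with $h_{m,r}=0$ for all $r\ne 0,m$ and $\phi(\tau,0)=0$. Put $\xi^*_m=\theta_{m,m}\theta_{m,0}'-\theta_{m,0}\theta_{m,m}'$, let $$S^*_{k+2}(\Gamma_0(mN),\chi)^0=\{f\in S_{k+2}(\Gamma_0(mN),\chi): f/\xi^*_m\in M_{k-1}(\Gamma_0(mN),\chi\overline{\omega}_m)\},$$ and let $D_2=\left(\frac{k}{2\pi i}\frac{\partial^2}{\partial z^2}-2m\frac{\partial}{\partial\tau}\right)\Big|_{z=0}$. Then: 1. $\xi^*_m(\tau)=-\pi i\,m\,\eta(m\tau)^6$ for all $\tau\in\mathbb H$, where $\eta$ is the Dedekind eta function. 2. $D_2$ is a linear map from $J_{k,m}(\Gamma_0(mN),\chi)$ to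 $S_{k+2}(\Gamma_0(mN),\chi)$. On $J^*_{k,m}(\Gamma_0(mN),\chi)^0$ it agrees with $\left(\frac{k}{2\pi i}\frac{\partial^2}{\partial z^2}-a\frac{\partial}{\partial\tau}\right)\Big|_{z=0}$ for every $a\in\mathbb C$. 3. $D_2$ restricts to a linear isomorphism $J^*_{k,m}(\Gamma_0(mN),\chi)^0\to S^*_{k+2}(\Gamma_0(mN),\chi)^0$. 4. The map $\Lambda^*_m:\phi\mapsto\frac{h_{m,0}}{\theta_{m,m}}=-\frac{h_{m,m}}{\theta_{m,0}}$ is a linear isomorphism $J^*_{k,m}(\Gamma_0(mN),\chi)^0\to M_{k-1}(\Gamma_0(mN),\chi\overline{\omega}_m)$, the map $\varphi\mapsto 4mk\,\xi^*_m\varphi$ is a linear isomorphism $M_{k-1}(\Gamma_0(mN),\chi\overline{\omega}_m)\to S^*_{k+2}(\Gamma_0(mN),\chi)^0$, and its composition with $\Lambda^*_m$ is $D_2$ on $J^*_{k,m}(\Gamma_0(mN),\chi)^0$. -/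

import Mathlib

open UpperHalfPlane hiding I
open Complex MatrixGroups CongruenceSubgroup ModularForm Manifold
open scoped Real

noncomputable section

namespace JacobiRestriction

/-- The automorphy factor `c τ + d`. -/
def autFactor (γ : SL(2, ℤ)) (τ : ℍ) : ℂ := (γ 1 0 : ℂ) * (τ : ℂ) + (γ 1 1 : ℂ)

/-! ### Theta functions and the theta multiplier -/

/-- The Jacobi theta series
`θ^J_{m,r}(τ,z) = ∑_{n ∈ ℤ} exp (2πi m ((n + r/2m)² τ + 2 (n + r/2m) z))`. -/
def thetaJ (m r : ℕ) (τ z : ℂ) : ℂ :=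
  ∑' n : ℤ, cexp (2 * π * I * m *
    (((n : ℂ) + (r : ℂ) / (2 * m)) ^ 2 * τ + 2 * ((n : ℂ) + (r : ℂ) / (2 * m)) * z))

/-- The theta constant `θ_{m,r}(τ) = θ^J_{m,r}(τ,0)`. -/
def theta (m r : ℕ) (τ : ℂ) : ℂ := thetaJ m r τ 0

/-- `U` is the matrix of the transformation law of the column vector `(θ^J_{m,r})_{0 ≤ r < 2m}`
under `γ`:
`Θ^J(γ(τ,z)) = exp (2πi m c z² / (cτ+d)) (cτ+d)^{1/2} U Θ^J(τ,z)` (principal square root). -/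
def IsThetaMultiplier (m : ℕ) (γ : SL(2, ℤ)) (U : Matrix (Fin (2 * m)) (Fin (2 * m)) ℂ) : Prop :=
  ∀ (τ : ℍ) (z : ℂ) (r : Fin (2 * m)),
    thetaJ m r ((γ • τ : ℍ) : ℂ) (z / autFactor γ τ) =
      cexp (2 * π * I * m * ((γ 1 0 : ℂ) * z ^ 2 / autFactor γ τ)) *
        autFactor γ τ ^ (1 / 2 : ℂ) * ∑ s : Fin (2 * m), U r s * thetaJ m s (τ : ℂ) z

/-- The matrix `U_m(γ)` of the transformation law of the theta vector. It exists, and it is unique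
because the functions `θ^J_{m,r}` with `0 ≤ r < 2m` are linearly independent. -/
def thetaMultiplier (m : ℕ) (γ : SL(2, ℤ)) : Matrix (Fin (2 * m)) (Fin (2 * m)) ℂ :=
  Classical.epsilon (IsThetaMultiplier m γ)

/-- For `γ = (a, b; c, d) ∈ Γ₀(m)`, the matrix `γ_m = (a, bm; c/m, d) ∈ SL₂(ℤ)`. -/
def conjLevel (m : ℕ) (γ : Gamma0 m) : SL(2, ℤ) :=
  ⟨!![γ.1 0 0, γ.1 0 1 * m; γ.1 1 0 / m, γ.1 1 1], by
    have hdvd : (m : ℤ) ∣ γ.1 1 0 :=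
      (ZMod.intCast_zmod_eq_zero_iff_dvd _ m).1 (Gamma0_mem.1 γ.2)
    have hdet := γ.1.det_coe
    rw [Matrix.det_fin_two] at hdet
    rw [Matrix.det_fin_two_of, mul_assoc, Int.mul_ediv_cancel' hdvd, hdet]⟩

/-- The character `ω_m(γ) = det U_1(γ_m)` of `Γ₀(m)`. -/
def omega (m : ℕ) (γ : Gamma0 m) : ℂ := (thetaMultiplier 1 (conjLevel m γ)).det

/-- `ξ*_m = θ_{m,m} θ_{m,0}' - θ_{m,0} θ_{m,m}'`. -/
def xiStar (m : ℕ) (τ : ℍ) : ℂ :=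
  theta m m τ * deriv (theta m 0) τ - theta m 0 τ * deriv (theta m m) τ

/-! ### Modular forms and cusp forms on `Γ₀(N)` with a multiplier -/

/-- The space of modular forms of weight `k` on `Γ₀(N)` with character `v`: holomorphic functions
`f` on `ℍ` with `f(γτ) = v(γ) (cτ+d)^k f(τ)` for `γ ∈ Γ₀(N)` that are holomorphic at the cusps. -/
def modularForms (k : ℤ) (N : ℕ) (v : Gamma0 N → ℂ) : Submodule ℂ (ℍ → ℂ) where
  carrier := {f | MDiff f ∧
    (∀ (γ : Gamma0 N) (τ : ℍ), f (γ.1 • τ) = v γ * autFactor γ.1 τ ^ k * f τ) ∧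
    ∀ g : SL(2, ℤ), IsBoundedAtImInfty (f ∣[k] g)}
  zero_mem' := by
    refine ⟨mdifferentiable_const, by simp, fun g ↦ ?_⟩
    rw [SlashAction.zero_slash]
    exact (zero_form_isBoundedAtImInfty)
  add_mem' := by
    rintro f g ⟨hf1, hf2, hf3⟩ ⟨hg1, hg2, hg3⟩
    refine ⟨hf1.add hg1, fun γ τ ↦ ?_, fun γ ↦ ?_⟩
    · simp only [Pi.add_apply, hf2 γ τ, hg2 γ τ]
      ring
    · rw [SlashAction.add_slash]
      exact (hf3 γ).add (hg3 γ)
  smul_mem' := by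
    rintro c f ⟨hf1, hf2, hf3⟩
    refine ⟨hf1.const_smul c, fun γ τ ↦ ?_, fun γ ↦ ?_⟩
    · simp only [Pi.smul_apply, hf2 γ τ, smul_eq_mul]
      ring
    · rw [ModularForm.SL_smul_slash]
      exact (hf3 γ).smul c

/-- The subspace of cusp forms: modular forms that vanish at all cusps. -/
def cuspForms (k : ℤ) (N : ℕ) (v : Gamma0 N → ℂ) : Submodule ℂ (ℍ → ℂ) where
  carrier := {f | f ∈ modularForms k N v ∧ ∀ g : SL(2, ℤ), IsZeroAtImInfty (f ∣[k] g)}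
  zero_mem' := by
    refine ⟨zero_mem _, fun g ↦ ?_⟩
    rw [SlashAction.zero_slash]
    exact Filter.zero_zeroAtFilter _
  add_mem' := by
    rintro f g ⟨hf1, hf2⟩ ⟨hg1, hg2⟩
    refine ⟨add_mem hf1 hg1, fun γ ↦ ?_⟩
    rw [SlashAction.add_slash]
    exact (hf2 γ).add (hg2 γ)
  smul_mem' := by
    rintro c f ⟨hf1, hf2⟩
    refine ⟨Submodule.smul_mem _ c hf1, fun γ ↦ ?_⟩
    rw [ModularForm.SL_smul_slash]
    exact (hf2 γ).smul c

/-- The character `γ = (a, b; c, d) ↦ χ(d)` of `Γ₀(N)`. -/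
def nebentypus {N : ℕ} (χ : DirichletCharacter ℂ N) (γ : Gamma0 N) : ℂ := χ ((γ.1 1 1 : ℤ) : ZMod N)

lemma Gamma0_mul_le (m N : ℕ) : Gamma0 (m * N) ≤ Gamma0 m := fun γ hγ ↦ by
  rw [Gamma0_mem, ZMod.intCast_zmod_eq_zero_iff_dvd] at *
  exact dvd_trans ⟨(N : ℤ), by push_cast; ring⟩ hγ

/-- The character `χ ω̄_m` of `Γ₀(mN)`. -/
def twistedNebentypus (m : ℕ) {N : ℕ} (χ : DirichletCharacter ℂ (m * N)) (γ : Gamma0 (m * N)) : ℂ :=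
  nebentypus χ γ * starRingEnd ℂ (omega m ⟨γ.1, Gamma0_mul_le m N γ.2⟩)

/-! ### Jacobi forms -/

/-- `(φ|_{k,m} g)(τ,z) = (cτ+d)^{-k} exp (-2πi m c z² / (cτ+d)) φ(g(τ,z))`. -/
def jacobiSlash (k : ℤ) (m : ℕ) (g : SL(2, ℤ)) (φ : ℍ → ℂ → ℂ) (τ : ℍ) (z : ℂ) : ℂ :=
  autFactor g τ ^ (-k) * cexp (-(2 * π * I * m * ((g 1 0 : ℂ) * z ^ 2 / autFactor g τ))) *
    φ (g • τ) (z / autFactor g τ)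

/-- `φ` has a Fourier expansion `∑ c(n,r) q^{n/N} ζ^r` over integers `n`, `r`, where `c(n,r) = 0`
unless `r² ≤ 4 m (n/N)`. -/
def HasJacobiExpansion (m N : ℕ) (φ : ℍ → ℂ → ℂ) : Prop :=
  ∃ c : ℤ → ℤ → ℂ, (∀ n r : ℤ, 4 * m * n < N * r ^ 2 → c n r = 0) ∧
    ∀ (τ : ℍ) (z : ℂ),
      HasSum (fun p : ℤ × ℤ ↦ c p.1 p.2 * cexp (2 * π * I * (p.1 * (τ : ℂ) / N + p.2 * z))) (φ τ z)

/-- The space `J_{k,m}(Γ₀(N), χ)` of Jacobi forms of weight `k`, index `m` and character `χ` for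
the Jacobi group `Γ₀(N) ⋉ ℤ²`. -/
def jacobiForms (k : ℤ) (m N : ℕ) (χ : DirichletCharacter ℂ N) : Submodule ℂ (ℍ → ℂ → ℂ) where
  carrier := {φ |
    DifferentiableOn ℂ (fun p : ℂ × ℂ ↦ φ (ofComplex p.1) p.2) {p | 0 < p.1.im} ∧
    (∀ (γ : Gamma0 N) (τ : ℍ) (z : ℂ), φ (γ.1 • τ) (z / autFactor γ.1 τ) =
      nebentypus χ γ * autFactor γ.1 τ ^ k *
        cexp (2 * π * I * m * ((γ.1 1 0 : ℂ) * z ^ 2 / autFactor γ.1 τ)) * φ τ z) ∧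
    (∀ (l μ : ℤ) (τ : ℍ) (z : ℂ), φ τ (z + l * τ + μ) =
      cexp (-(2 * π * I * m * ((l : ℂ) ^ 2 * τ + 2 * l * z))) * φ τ z) ∧
    ∀ g : SL(2, ℤ), HasJacobiExpansion m N (jacobiSlash k m g φ)}
  zero_mem' := by
    refine ⟨differentiableOn_const 0, by simp, by simp, fun g ↦ ⟨0, by simp, fun τ z ↦ ?_⟩⟩
    simp [jacobiSlash, hasSum_zero]
  add_mem' := by
    rintro φ ψ ⟨h1, h2, h3, h4⟩ ⟨h1', h2', h3', h4'⟩
    refine ⟨h1.add h1', fun γ τ z ↦ ?_, fun l μ τ z ↦ ?_, fun g ↦ ?_⟩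
    · simp only [Pi.add_apply, h2, h2']
      ring
    · simp only [Pi.add_apply, h3, h3']
      ring
    · obtain ⟨c, hc, hs⟩ := h4 g
      obtain ⟨c', hc', hs'⟩ := h4' g
      refine ⟨c + c', fun n r h ↦ by simp [hc n r h, hc' n r h], fun τ z ↦ ?_⟩
      convert (hs τ z).add (hs' τ z) using 1
      · ext p
        simp only [Pi.add_apply]
        ring
      · simp only [jacobiSlash, Pi.add_apply]
        ring
  smul_mem' := by
    rintro a φ ⟨h1, h2, h3, h4⟩
    refine ⟨h1.const_smul a, fun γ τ z ↦ ?_, fun l μ τ z ↦ ?_, fun g ↦ ?_⟩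
    · simp only [Pi.smul_apply, smul_eq_mul, h2]
      ring
    · simp only [Pi.smul_apply, smul_eq_mul, h3]
      ring
    · obtain ⟨c, hc, hs⟩ := h4 g
      refine ⟨a • c, fun n r h ↦ by simp [hc n r h], fun τ z ↦ ?_⟩
      have e : jacobiSlash k m g (a • φ) τ z = a * jacobiSlash k m g φ τ z := by
        simp only [jacobiSlash, Pi.smul_apply, smul_eq_mul]
        ring
      rw [e]
      simpa [mul_assoc] using (hs τ z).mul_left a

/-- The functions `h_{m,r}` with `0 ≤ r < 2m` are the components of the theta decomposition
`φ = ∑_{0 ≤ r < 2m} h_{m,r} θ^J_{m,r}`. -/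
def IsThetaDecomposition (m : ℕ) (φ : ℍ → ℂ → ℂ) (h : ℕ → ℍ → ℂ) : Prop :=
  ∀ (τ : ℍ) (z : ℂ), φ τ z = ∑ r ∈ Finset.range (2 * m), h r τ * thetaJ m r τ z

/-- The space `J*_{k,m}(Γ₀(mN), χ)⁰` of the Jacobi forms whose theta components `h_{m,r}` vanish
for all `r ≠ 0, m` and whose restriction to `z = 0` vanishes. -/
def jacobiStarKernel (k : ℤ) (m N : ℕ) (χ : DirichletCharacter ℂ (m * N)) :
    Submodule ℂ (ℍ → ℂ → ℂ) where
  carrier := {φ | φ ∈ jacobiForms k m (m * N) χ ∧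
    (∃ h : ℕ → ℍ → ℂ, IsThetaDecomposition m φ h ∧
      ∀ r < 2 * m, r ≠ 0 → r ≠ m → h r = 0) ∧
    ∀ τ : ℍ, φ τ 0 = 0}
  zero_mem' := ⟨zero_mem _, ⟨0, by simp [IsThetaDecomposition], by simp⟩, by simp⟩
  add_mem' := by
    rintro φ ψ ⟨h1, ⟨h, hd, hv⟩, h3⟩ ⟨h1', ⟨h', hd', hv'⟩, h3'⟩
    refine ⟨add_mem h1 h1', ⟨h + h', fun τ z ↦ ?_, fun r a b c ↦ ?_⟩, fun τ ↦ ?_⟩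
    · simp [hd τ z, hd' τ z, add_mul, Finset.sum_add_distrib]
    · simp [hv r a b c, hv' r a b c]
    · simp [h3, h3']
  smul_mem' := by
    rintro a φ ⟨h1, ⟨h, hd, hv⟩, h3⟩
    refine ⟨Submodule.smul_mem _ a h1, ⟨a • h, fun τ z ↦ ?_, fun r a b c ↦ ?_⟩, fun τ ↦ ?_⟩
    · simp [hd τ z, Finset.mul_sum, mul_assoc]
    · simp [hv r a b c]
    · simp [h3]

/-- The operator `((k/2πi) ∂²/∂z² - a ∂/∂τ)|_{z=0}`. -/
def heatOperator (k : ℕ) (a : ℂ) (φ : ℍ → ℂ → ℂ) (τ : ℍ) : ℂ :=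
  (k : ℂ) / (2 * π * I) * iteratedDeriv 2 (fun z : ℂ ↦ φ τ z) 0 -
    a * deriv (fun w : ℂ ↦ φ (ofComplex w) 0) (τ : ℂ)

/-- The operator `D₂ = ((k/2πi) ∂²/∂z² - 2m ∂/∂τ)|_{z=0}` on functions of index `m`. -/
def D₂ (k m : ℕ) (φ : ℍ → ℂ → ℂ) : ℍ → ℂ := heatOperator k (2 * m) φ

/-- The space `S*_{k+2}(Γ₀(mN), χ)⁰` of the cusp forms `f` of weight `k + 2` with
`f / ξ*_m ∈ M_{k-1}(Γ₀(mN), χ ω̄_m)`. -/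
def cuspStar (k : ℤ) (m N : ℕ) (χ : DirichletCharacter ℂ (m * N)) : Submodule ℂ (ℍ → ℂ) where
  carrier := {f | f ∈ cuspForms (k + 2) (m * N) (nebentypus χ) ∧
    f / xiStar m ∈ modularForms (k - 1) (m * N) (twistedNebentypus m χ)}
  zero_mem' := ⟨zero_mem _, by 
    convert zero_mem (modularForms (k - 1) (m * N) (twistedNebentypus m χ)) using 1
    ext τ
    simp⟩
  add_mem' := by
    rintro f g ⟨h1, h2⟩ ⟨h1', h2'⟩
    exact ⟨add_mem h1 h1', by
      convert add_mem h2 h2' using 1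
      ext τ
      simp [add_div]⟩
  smul_mem' := by
    rintro a f ⟨h1, h2⟩
    exact ⟨Submodule.smul_mem _ a h1, by
      convert Submodule.smul_mem _ a h2 using 1
      ext τ
      simp [mul_div_assoc]⟩

end JacobiRestriction

end

open JacobiRestriction

open Filter Topology

noncomputable section

namespace JacobiRestriction

/-! ### Exponential series -/

section ExponentialSeries

variable {ι : Type*} {c : ι → ℂ} {y : ι → ℝ}

/-! Two theta components and one linear relation leave one free function. If only `h_{m,0}` and
`h_{m,m}` survive and `φ(τ,0) = 0`, then `h_{m,0} θ_{m,0} + h_{m,m} θ_{m,m} = 0`. Neither theta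
constant vanishes on `ℍ`, so `φ = f · (θ_{m,m} θ^J_{m,0} - θ_{m,0} θ^J_{m,m})` with `f =
h_{m,0}/θ_{m,m}` (`exists_eq_starForm`). Since `r/2m` is `0` or `1/2` for these two components, the
bracket is `thetaWedge (mτ) (mz)`, where `thetaWedge` is the 2×2 determinant of the index 1 theta
vectors at `(τ,0)` and `(τ,z)`. The multiplier matrix acts on a determinant by its own determinant,
which is where `ω_m` and the weight drop from `k` to `k - 1` come from. All isomorphisms reduce to
`f ↦ starForm m f`.

The heat equation turns the second `z`-derivative of the bracket at `0` into `ξ*_m`, so `D₂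
(starForm m f) = 4mk ξ*_m f` (`D₂_starForm`). A function with the multiplier of `η⁶` and the right
behaviour at infinity is a multiple of `η⁶` (`eq_const_mul_eta_pow_six`). This computes `ξ*_1` and
`θ_{1,0} θ_{1,1} (θ_{1,0}⁴ - θ_{1,1}⁴)`, and gives every nonvanishing statement needed for division.

The delicate point is the cusps. Writing `diag(m,1) g = g' (a, b; 0, d)` expresses the slash of
`starForm m f` by `g` as `f ∣[k-1] g` times the wedge at `((aτ+b)/d, az)`. The coefficient of `ζ^a`
then has exactly the decay allowed by `r² ≤ 4mn/M`, so boundedness of `f ∣[k-1] g` and the Jacobi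
expansion condition imply each other (`isBoundedAtImInfty_slash_of_starForm`,
`IsScaleFactorization.hasJacobiExpansion_starForm`). -/

lemma norm_cexp_I_mul (y : ℝ) (w : ℂ) : ‖cexp (I * y * w)‖ = Real.exp (-(y * w.im)) := by
  rw [Complex.norm_exp]
  simp

/-- Nonnegative frequencies make every term largest on the boundary line, so summability at the
single point `tI` gives a uniform majorant on a half-plane. -/
lemma norm_mul_cexp_le (hy : ∀ i, c i ≠ 0 → 0 ≤ y i) {t : ℝ} {w : ℂ} (hw : t ≤ w.im) (i : ι) :
    ‖c i * cexp (I * y i * w)‖ ≤ ‖c i * cexp (I * y i * (t * I))‖ := by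
  rcases eq_or_ne (c i) 0 with h | h
  · simp [h]
  · rw [norm_mul, norm_mul, norm_cexp_I_mul, norm_cexp_I_mul]
    gcongr
    · exact hy i h
    · simpa using hw

theorem differentiableOn_tsum_cexp (hy : ∀ i, c i ≠ 0 → 0 ≤ y i)
    (hs : ∀ w : ℂ, 0 < w.im → Summable fun i ↦ c i * cexp (I * y i * w)) :
    DifferentiableOn ℂ (fun w ↦ ∑' i, c i * cexp (I * y i * w)) {w | 0 < w.im} := by
  intro w hw
  obtain ⟨t, ht, htw⟩ := exists_between (show 0 < w.im from hw)
  have hU : IsOpen {w : ℂ | t < w.im} := isOpen_lt continuous_const continuous_im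
  refine ((differentiableOn_tsum_of_summable_norm (hs (t * I) (by simpa using ht)).norm
    (fun i ↦ ?_) hU fun i w hw ↦ norm_mul_cexp_le hy (le_of_lt hw) i).differentiableAt
      (hU.mem_nhds htw)).differentiableWithinAt
  exact (Differentiable.differentiableOn (by fun_prop))

theorem hasSum_deriv_tsum_cexp (hy : ∀ i, c i ≠ 0 → 0 ≤ y i)
    (hs : ∀ w : ℂ, 0 < w.im → Summable fun i ↦ c i * cexp (I * y i * w)) {w : ℂ} (hw : 0 < w.im) :
    HasSum (fun i ↦ c i * (I * y i) * cexp (I * y i * w))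
      (deriv (fun w ↦ ∑' i, c i * cexp (I * y i * w)) w) := by
  obtain ⟨t, ht, htw⟩ := exists_between hw
  have hU : IsOpen {w : ℂ | t < w.im} := isOpen_lt continuous_const continuous_im
  have := hasSum_deriv_of_summable_norm (hs (t * I) (by simpa using ht)).norm
    (fun i ↦ Differentiable.differentiableOn (by fun_prop)) hU
      (fun i w hw ↦ norm_mul_cexp_le hy (le_of_lt hw) i) htw
  convert! this using 2 with i
  have h : HasDerivAt (fun w : ℂ ↦ c i * cexp (I * y i * w))
      (c i * (cexp (I * y i * w) * (I * y i * 1))) w :=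
    (((hasDerivAt_id w).const_mul (I * (y i : ℂ))).cexp).const_mul (c i)
  rw [h.deriv]
  ring

theorem exists_norm_le_of_hasSum_cexp {δ : ℝ} (hy : ∀ i, c i ≠ 0 → δ ≤ y i)
    (hs : Summable fun i ↦ c i * cexp (I * y i * I)) :
    ∃ C, ∀ (w S : ℂ), 1 ≤ w.im → HasSum (fun i ↦ c i * cexp (I * y i * w)) S →
      ‖S‖ ≤ C * Real.exp (-(δ * w.im)) := by
  -- The factor `e^δ` comes from `(y - δ)(Im w - 1) ≥ 0`, that is, `-y Im w ≤ -y + δ - δ Im w`.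
  refine ⟨(∑' i, ‖c i * cexp (I * y i * I)‖) * Real.exp δ, fun w S hw hS ↦ ?_⟩
  rw [mul_assoc, ← Real.exp_add, ← hS.tsum_eq, ← tsum_mul_right]
  refine tsum_of_norm_bounded (hs.norm.mul_right _).hasSum fun i ↦ ?_
  rcases eq_or_ne (c i) 0 with h | h
  · simp [h]
  · rw [norm_mul, norm_mul, norm_cexp_I_mul, norm_cexp_I_mul, mul_assoc, ← Real.exp_add]
    gcongr
    have := hy i h
    rw [Complex.I_im]
    nlinarith

/-- The frequency-zero terms in `s` form the limit and the rest is `O(e^{-δ Im τ})`. With `s = ∅`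
this is vanishing at infinity. -/
theorem tendsto_atImInfty_of_hasSum_cexp {G : ℍ → ℂ} {δ : ℝ} (hδ : 0 < δ) (s : Finset ι)
    (hG : ∀ τ : ℍ, HasSum (fun i ↦ c i * cexp (I * y i * τ)) (G τ))
    (h0 : ∀ i ∈ s, y i = 0) (hy : ∀ i, i ∉ s → c i ≠ 0 → δ ≤ y i) :
    Tendsto G atImInfty (𝓝 (∑ i ∈ s, c i)) := by
  classical
  let c' : ι → ℂ := fun i ↦ if i ∈ s then 0 else c i
  have hG' (τ : ℍ) : HasSum (fun i ↦ c' i * cexp (I * y i * τ)) (G τ - ∑ i ∈ s, c i) := by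
    have h2 : HasSum (fun i ↦ if i ∈ s then c i else 0) (∑ i ∈ s, c i) := by
      have : HasSum (fun i ↦ if i ∈ s then c i else 0) (∑ i ∈ s, if i ∈ s then c i else 0) :=
        hasSum_sum_of_ne_finset_zero fun i hi ↦ if_neg hi
      rwa [Finset.sum_congr rfl fun i hi ↦ if_pos hi] at this
    convert! (hG τ).sub h2 using 2 with i
    by_cases hi : i ∈ s <;> simp [c', hi, h0]
  obtain ⟨C, hC⟩ := exists_norm_le_of_hasSum_cexp (c := c') (y := y) (δ := δ)
    (fun i hi ↦ hy i (by grind) (by grind)) (by simpa using (hG' UpperHalfPlane.I).summable)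
  rw [tendsto_iff_norm_sub_tendsto_zero]
  have hlim : Tendsto (fun τ : ℍ ↦ C * Real.exp (-(δ * τ.im))) atImInfty (𝓝 0) := by
    rw [← mul_zero C]
    refine (Real.tendsto_exp_neg_atTop_nhds_zero.comp
      (Tendsto.const_mul_atTop hδ tendsto_comap)).const_mul C
  refine squeeze_zero' (.of_forall fun _ ↦ norm_nonneg _) ?_ hlim
  have hev : ∀ᶠ τ : ℍ in atImInfty, 1 ≤ τ.im := tendsto_comap.eventually_ge_atTop 1
  filter_upwards [hev] with τ hτ
  exact hC τ _ hτ (hG' τ)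

theorem hasSum_iteratedDeriv_two_tsum_cexp {x : ι → ℝ}
    (hs : ∀ z : ℂ, Summable fun i ↦ c i * cexp (I * x i * z)) :
    HasSum (fun i ↦ -(c i * x i ^ 2))
      (iteratedDeriv 2 (fun z ↦ ∑' i, c i * cexp (I * x i * z)) 0) := by
  -- The frequencies may have both signs, so summability at `I` and at `-I` is combined to control
  -- `e^{|x|}`.
  have hsum : Summable fun i ↦ ‖c i‖ * Real.exp |x i| := by
    refine .of_nonneg_of_le (fun i ↦ by positivity) (fun i ↦ ?_) ((hs I).norm.add (hs (-I)).norm)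
    rw [norm_mul, norm_mul, norm_cexp_I_mul, norm_cexp_I_mul, ← mul_add]
    gcongr
    simpa [add_comm] using Real.exp_abs_le (x i)
  have hexp (i : ι) (w : ℂ) : ‖cexp (I * x i * w)‖ ≤ Real.exp (|x i| * ‖w‖) := by
    rw [norm_cexp_I_mul]
    gcongr
    calc -(x i * w.im) ≤ |x i * w.im| := neg_le_abs _
      _ ≤ |x i| * ‖w‖ := by rw [abs_mul]; gcongr; exact abs_im_le_norm w
  have hd (i : ι) (w : ℂ) :
      HasDerivAt (fun w : ℂ ↦ c i * cexp (I * x i * w)) (c i * (I * x i) * cexp (I * x i * w)) w :=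
    ((((hasDerivAt_id' w).const_mul (I * (x i : ℂ))).cexp).const_mul (c i)).congr_deriv (by ring)
  have hd2 (i : ι) (w : ℂ) : HasDerivAt (fun w : ℂ ↦ c i * (I * x i) * cexp (I * x i * w))
      (-(c i * x i ^ 2) * cexp (I * x i * w)) w :=
    ((((hasDerivAt_id' w).const_mul (I * (x i : ℂ))).cexp).const_mul (c i * (I * x i))).congr_deriv
      (by linear_combination (c i * x i ^ 2 * cexp (I * x i * w)) * I_sq)
  have h1 (w : ℂ) (hw : w ∈ Metric.ball (0 : ℂ) 1) :
      deriv (fun z ↦ ∑' i, c i * cexp (I * x i * z)) w =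
        ∑' i, c i * (I * x i) * cexp (I * x i * w) := by
    have := hasSum_deriv_of_summable_norm (F := fun i z ↦ c i * cexp (I * x i * z)) hsum
      (fun i ↦ Differentiable.differentiableOn (by fun_prop)) Metric.isOpen_ball (fun i w hw ↦ by
        rw [norm_mul]
        gcongr
        refine (hexp i w).trans (Real.exp_le_exp.2 ?_)
        have : ‖w‖ ≤ 1 := by simpa using (mem_ball_zero_iff.1 hw).le
        nlinarith [abs_nonneg (x i)]) hw
    rw [← this.tsum_eq]
    exact tsum_congr fun i ↦ (hd i w).deriv
  -- The radius drops to `1/2` to pay for the new factor `|x|`, through `|x| ≤ 2 e^{|x|/2}`.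
  have h2 := hasSum_deriv_of_summable_norm (F := fun i z ↦ c i * (I * x i) * cexp (I * x i * z))
      (hsum.mul_left 2) (U := Metric.ball 0 (1 / 2)) (z := 0)
      (fun i ↦ Differentiable.differentiableOn (by fun_prop)) Metric.isOpen_ball (fun i w hw ↦ by
        rw [norm_mul, norm_mul, mul_left_comm, mul_assoc, norm_mul, norm_I, one_mul, norm_real,
          Real.norm_eq_abs]
        refine mul_le_mul_of_nonneg_left ?_ (norm_nonneg _)
        have hw' : ‖w‖ ≤ 1 / 2 := by simpa using (mem_ball_zero_iff.1 hw).le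
        have h3 : Real.exp (|x i| * ‖w‖) ≤ Real.exp (|x i| / 2) :=
          Real.exp_le_exp.2 (by nlinarith [abs_nonneg (x i)])
        have h4 : |x i| / 2 ≤ Real.exp (|x i| / 2) := by
          linarith [Real.add_one_le_exp (|x i| / 2)]
        calc |x i| * ‖cexp (I * x i * w)‖
            ≤ (2 * Real.exp (|x i| / 2)) * Real.exp (|x i| / 2) := by
              gcongr
              · linarith
              · exact (hexp i w).trans h3
          _ = 2 * Real.exp |x i| := by rw [mul_assoc, ← Real.exp_add, add_halves])
      (by simp)
  rw [iteratedDeriv_succ, iteratedDeriv_one]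
  have hev : deriv (fun z ↦ ∑' i, c i * cexp (I * x i * z)) =ᶠ[𝓝 0]
      fun w ↦ ∑' i, c i * (I * x i) * cexp (I * x i * w) := by
    filter_upwards [Metric.ball_mem_nhds (0 : ℂ) one_pos] with w hw using h1 w hw
  rw [hev.deriv_eq]
  convert! h2 using 2 with i
  rw [(hd2 i 0).deriv]
  simp

end ExponentialSeries

/-! ### Fourier coefficients of `1`-periodic functions -/

/-- The coefficient of `exp (2πi a z)` in the Fourier expansion of `F`. -/
def fourierMode (a : ℤ) (F : ℂ → ℂ) : ℂ := ∫ t in (0 : ℝ)..1, F t * cexp (-(2 * π * I * (a * t)))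

lemma fourierMode_const_mul (a : ℤ) (b : ℂ) (F : ℂ → ℂ) :
    fourierMode a (fun z ↦ b * F z) = b * fourierMode a F := by
  simp [fourierMode, mul_assoc]

lemma integral_cexp_two_pi_I (n : ℤ) :
    ∫ t in (0 : ℝ)..1, cexp (2 * π * I * (n * t)) = if n = 0 then 1 else 0 := by
  split_ifs with h
  · simp [h]
  · have hc : (2 * π * I * n : ℂ) ≠ 0 := mul_ne_zero two_pi_I_ne_zero (mod_cast h)
    have := integral_exp_mul_complex (a := 0) (b := 1) hc
    simp only [mul_assoc] at this ⊢
    rw [this]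
    have e : cexp (2 * (π * (I * (n * (1 : ℝ))))) = 1 := by
      rw [Complex.exp_eq_one_iff]
      exact ⟨n, by push_cast; ring⟩
    rw [e]
    simp

/-- The case `t = 0` gives absolute convergence of the coefficients, so the series may be integrated
term by term against an orthogonal family. Frequencies may repeat in the index set. -/
theorem hasSum_fourierMode {ι : Type*} [Countable ι] {A : ι → ℂ} {r : ι → ℤ} {F : ℂ → ℂ}
    (hF : ∀ t : ℝ, HasSum (fun i ↦ A i * cexp (2 * π * I * (r i * (t : ℂ)))) (F t)) (a : ℤ) :
    HasSum (fun i ↦ if r i = a then A i else 0) (fourierMode a F) := by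
  let f : ι → C(ℝ, ℂ) := fun i ↦ ⟨fun t ↦ A i * cexp (2 * π * I * ((r i - a : ℤ) * (t : ℂ))), by
    fun_prop⟩
  have hA : Summable fun i ↦ ‖A i‖ := by simpa using (hF 0).summable.norm
  have hle (i : ι) : ‖(f i).restrict (⟨Set.uIcc 0 1, isCompact_uIcc⟩ :
      TopologicalSpace.Compacts ℝ)‖ ≤ ‖A i‖ := by
    refine (ContinuousMap.norm_le _ (norm_nonneg _)).2 fun t ↦ ?_
    have e : (2 * π * I * ((r i - a : ℤ) * ((t : ℝ) : ℂ))) =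
      ((2 * π * (r i - a : ℤ) * t : ℝ) : ℂ) * I := by push_cast; ring
    simp only [f, ContinuousMap.restrict_apply, ContinuousMap.coe_mk]
    rw [norm_mul, e, norm_exp_ofReal_mul_I, mul_one]
  have h := intervalIntegral.hasSum_intervalIntegral_of_summable_norm (a := 0) (b := 1) (f := f)
    (.of_nonneg_of_le (fun _ ↦ norm_nonneg _) hle hA)
  have hfun (t : ℝ) : ∑' i, f i t = F t * cexp (-(2 * π * I * (a * t))) := by
    rw [← (hF t).tsum_eq, ← tsum_mul_right]
    refine tsum_congr fun i ↦ ?_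
    simp only [f, ContinuousMap.coe_mk]
    conv_rhs => rw [mul_assoc (A i), ← Complex.exp_add]
    push_cast
    ring_nf
  simp only [hfun] at h
  refine h.congr_fun fun i ↦ ?_
  simp only [f, ContinuousMap.coe_mk, intervalIntegral.integral_const_mul,
    integral_cexp_two_pi_I, sub_eq_zero]
  split_ifs <;> simp

/-! ### The theta series -/

section Theta

variable {m r : ℕ} {τ z : ℂ}

lemma thetaJ_term_eq (hm : m ≠ 0) (r : ℕ) (τ z : ℂ) (n : ℤ) :
    cexp (2 * π * I * m * (((n : ℂ) + (r : ℂ) / (2 * m)) ^ 2 * τ +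
      2 * ((n : ℂ) + (r : ℂ) / (2 * m)) * z)) =
    cexp (2 * π * I * (r ^ 2 * τ / (4 * m) + r * z)) *
      jacobiTheta₂_term n (r * τ + 2 * m * z) (2 * m * τ) := by
  have : (m : ℂ) ≠ 0 := mod_cast hm
  rw [jacobiTheta₂_term, ← Complex.exp_add]
  congr 1
  field_simp
  ring

/-- Convergence, holomorphy and the inversion formula are inherited from `jacobiTheta₂` through this
identity. -/
lemma thetaJ_eq_jacobiTheta₂ (hm : m ≠ 0) (r : ℕ) (τ z : ℂ) :
    thetaJ m r τ z = cexp (2 * π * I * (r ^ 2 * τ / (4 * m) + r * z)) *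
      jacobiTheta₂ (r * τ + 2 * m * z) (2 * m * τ) := by
  simp only [thetaJ, thetaJ_term_eq hm, tsum_mul_left, jacobiTheta₂]

lemma im_two_mul_natCast_mul_pos (hm : m ≠ 0) (hτ : 0 < τ.im) : 0 < (2 * m * τ).im := by
  have : 0 < m := Nat.pos_of_ne_zero hm
  rw [show (2 * m * τ : ℂ) = ((2 * m : ℝ) : ℂ) * τ by push_cast; ring, im_ofReal_mul]
  positivity

lemma hasSum_thetaJ (hm : m ≠ 0) (r : ℕ) (hτ : 0 < τ.im) (z : ℂ) :
    HasSum (fun n : ℤ ↦ cexp (2 * π * I * m * (((n : ℂ) + (r : ℂ) / (2 * m)) ^ 2 * τ +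
      2 * ((n : ℂ) + (r : ℂ) / (2 * m)) * z))) (thetaJ m r τ z) := by
  simp only [thetaJ_eq_jacobiTheta₂ hm, thetaJ_term_eq hm]
  exact (hasSum_jacobiTheta₂_term _ (im_two_mul_natCast_mul_pos hm hτ)).mul_left _

lemma differentiableOn_thetaJ (hm : m ≠ 0) (r : ℕ) :
    DifferentiableOn ℂ (fun p : ℂ × ℂ ↦ thetaJ m r p.1 p.2) {p | 0 < p.1.im} := by
  intro p hp
  refine DifferentiableAt.differentiableWithinAt ?_
  simp only [thetaJ_eq_jacobiTheta₂ hm]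
  have h1 : DifferentiableAt ℂ (fun q : ℂ × ℂ ↦ jacobiTheta₂ q.1 q.2)
      (r * p.1 + 2 * m * p.2, 2 * m * p.1) :=
    (hasFDerivAt_jacobiTheta₂ _ (im_two_mul_natCast_mul_pos hm hp)).differentiableAt
  have h2 : DifferentiableAt ℂ (fun p : ℂ × ℂ ↦ (r * p.1 + 2 * m * p.2, 2 * m * p.1)) p := by
    fun_prop
  refine .mul (by fun_prop) ?_
  exact DifferentiableAt.comp p h1 h2

lemma differentiableAt_thetaJ_snd (hm : m ≠ 0) (r : ℕ) (hτ : 0 < τ.im) (z : ℂ) :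
    DifferentiableAt ℂ (fun z ↦ thetaJ m r τ z) z := by
  have hU : IsOpen {p : ℂ × ℂ | 0 < p.1.im} :=
    isOpen_lt continuous_const (Complex.continuous_im.comp continuous_fst)
  exact DifferentiableAt.comp z (f := fun z ↦ (τ, z)) (g := fun p : ℂ × ℂ ↦ thetaJ m r p.1 p.2)
    ((differentiableOn_thetaJ hm r).differentiableAt (hU.mem_nhds hτ)) (by fun_prop)

lemma differentiableAt_theta (hm : m ≠ 0) (r : ℕ) (hτ : 0 < τ.im) :
    DifferentiableAt ℂ (theta m r) τ := by
  have hU : IsOpen {p : ℂ × ℂ | 0 < p.1.im} :=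
    isOpen_lt continuous_const (Complex.continuous_im.comp continuous_fst)
  exact DifferentiableAt.comp τ (f := fun τ ↦ (τ, (0 : ℂ)))
    (g := fun p : ℂ × ℂ ↦ thetaJ m r p.1 p.2)
    ((differentiableOn_thetaJ hm r).differentiableAt (hU.mem_nhds hτ)) (by fun_prop)

lemma cexp_two_pi_I_intCast (n : ℤ) : cexp (2 * π * I * n) = 1 := by
  rw [mul_comm, exp_int_mul_two_pi_mul_I]

lemma cexp_add_two_pi_I_intCast (x : ℂ) (n : ℤ) : cexp (x + 2 * π * I * n) = cexp x := by
  rw [Complex.exp_add, cexp_two_pi_I_intCast, mul_one]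

lemma thetaJ_add_lattice (hm : m ≠ 0) (r : ℕ) (l μ : ℤ) (τ z : ℂ) :
    thetaJ m r τ (z + l * τ + μ) =
      cexp (-(2 * π * I * m * ((l : ℂ) ^ 2 * τ + 2 * l * z))) * thetaJ m r τ z := by
  have hm' : (m : ℂ) ≠ 0 := mod_cast hm
  simp only [thetaJ]
  rw [← (Equiv.addRight l).tsum_eq (fun n : ℤ ↦ cexp (2 * π * I * m *
    (((n : ℂ) + (r : ℂ) / (2 * m)) ^ 2 * τ + 2 * ((n : ℂ) + (r : ℂ) / (2 * m)) * z))),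
    ← tsum_mul_left]
  refine tsum_congr fun n ↦ ?_
  rw [← Complex.exp_add, ← mul_one (cexp (_ + _)),
    ← cexp_two_pi_I_intCast ((2 * m * n + r) * μ), ← Complex.exp_add]
  congr 1
  simp only [Equiv.coe_addRight]
  push_cast
  field_simp
  ring

/-- The shifts `0/2m = 0` and `m/2m = 1/2` do not depend on `m`, so the components `r = 0` and `r =
m` come from index 1 by `(τ, z) ↦ (mτ, mz)`. -/
lemma thetaJ_zero_eq (m : ℕ) (τ z : ℂ) : thetaJ m 0 τ z = thetaJ 1 0 (m * τ) (m * z) := by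
  refine tsum_congr fun n ↦ ?_
  push_cast
  ring_nf

lemma thetaJ_self_eq (hm : m ≠ 0) (τ z : ℂ) : thetaJ m m τ z = thetaJ 1 1 (m * τ) (m * z) := by
  have hm' : (m : ℂ) ≠ 0 := mod_cast hm
  refine tsum_congr fun n ↦ ?_
  push_cast
  congr 1
  field_simp

lemma thetaJ_one_zero_add_intCast (n : ℤ) (τ z : ℂ) :
    thetaJ 1 0 (τ + n) z = thetaJ 1 0 τ z := by
  refine tsum_congr fun j ↦ ?_
  rw [← mul_one (cexp (2 * π * I * _ * (_ * τ + _))), ← cexp_two_pi_I_intCast (j ^ 2 * n),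
    ← Complex.exp_add]
  push_cast
  ring_nf

lemma thetaJ_one_one_add_intCast (n : ℤ) (τ z : ℂ) :
    thetaJ 1 1 (τ + n) z = cexp (2 * π * I * (n / 4)) * thetaJ 1 1 τ z := by
  simp only [thetaJ]
  rw [← tsum_mul_left]
  refine tsum_congr fun j ↦ ?_
  rw [← mul_one (cexp (2 * π * I * (n / 4)) * _), ← cexp_two_pi_I_intCast ((j ^ 2 + j) * n),
    ← Complex.exp_add, ← Complex.exp_add]
  push_cast
  ring_nf

/-! ### Inversion of the index 1 theta vector -/

lemma HasSum.even_add_odd_int {f : ℤ → ℂ} {a b : ℂ} (he : HasSum (fun n ↦ f (2 * n)) a)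
    (ho : HasSum (fun n ↦ f (2 * n + 1)) b) : HasSum f (a + b) := by
  have h2 := mul_right_injective₀ (two_ne_zero' ℤ)
  replace ho := ((add_left_injective (1 : ℤ)).comp h2).hasSum_range_iff.2 ho
  refine (h2.hasSum_range_iff.2 he).add_isCompl ?_ ho
  have := Int.isCompl_even_odd
  convert! this using 1
  · ext x
    simp [even_iff_exists_two_mul]
  · ext x
    simp [Set.mem_range, Odd, eq_comm]

/-- Even and odd summation indices give the two components. A shift of `z` by `1/2` multiplies the
`n`-th term by `(-1)^n`, which produces the difference instead of the sum. -/
lemma jacobiTheta₂_half (hτ : 0 < τ.im) (z : ℂ) :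
    jacobiTheta₂ z (τ / 2) = thetaJ 1 0 τ z + thetaJ 1 1 τ z := by
  have h2 : 0 < (τ / 2).im := by
    rw [div_ofNat_im]
    positivity
  refine (hasSum_jacobiTheta₂_term z h2).unique (HasSum.even_add_odd_int ?_ ?_)
  · refine (hasSum_thetaJ one_ne_zero 0 hτ z).congr_fun fun n ↦ ?_
    rw [jacobiTheta₂_term]
    push_cast
    ring_nf
  · refine (hasSum_thetaJ one_ne_zero 1 hτ z).congr_fun fun n ↦ ?_
    rw [jacobiTheta₂_term]
    push_cast
    ring_nf

lemma jacobiTheta₂_half_add_half (hτ : 0 < τ.im) (z : ℂ) :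
    jacobiTheta₂ (z + 1 / 2) (τ / 2) = thetaJ 1 0 τ z - thetaJ 1 1 τ z := by
  have h2 : 0 < (τ / 2).im := by
    rw [div_ofNat_im]
    positivity
  rw [sub_eq_add_neg]
  refine (hasSum_jacobiTheta₂_term _ h2).unique (HasSum.even_add_odd_int ?_ ?_)
  · refine (hasSum_thetaJ one_ne_zero 0 hτ z).congr_fun fun n ↦ ?_
    conv_rhs => rw [← cexp_add_two_pi_I_intCast _ n]
    rw [jacobiTheta₂_term]
    push_cast
    ring_nf
  · refine (hasSum_thetaJ one_ne_zero 1 hτ z).neg.congr_fun fun n ↦ ?_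
    conv_rhs => rw [neg_eq_neg_one_mul, ← Complex.exp_pi_mul_I, ← Complex.exp_add,
      ← cexp_add_two_pi_I_intCast _ n]
    rw [jacobiTheta₂_term]
    push_cast
    ring_nf

/-- The principal root is multiplicative here because `arg (-I/2) = -π/2` and `arg τ ∈ [0, π]`, so
the arguments add without leaving `(-π, π]`. -/
lemma neg_I_mul_half_cpow (hτ : 0 < τ.im) :
    (-I * (τ / 2)) ^ (1 / 2 : ℂ) = (-I / 2) ^ (1 / 2 : ℂ) * τ ^ (1 / 2 : ℂ) := by
  have h0 : τ ≠ 0 := by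
    rintro rfl
    simp at hτ
  have h1 : arg (-I / 2) = -(π / 2) := by
    rw [show -I / 2 = ((1 / 2 : ℝ) : ℂ) * -I by push_cast; ring, arg_real_mul _ (by norm_num),
      arg_neg_I]
  have h2 : 0 ≤ arg τ := arg_nonneg_iff.2 hτ.le
  rw [show -I * (τ / 2) = -I / 2 * τ by ring, cpow_def_of_ne_zero (by simp [h0]),
    cpow_def_of_ne_zero (by simp), cpow_def_of_ne_zero h0, ← Complex.exp_add,
    Complex.log_mul (by simp) h0 (by rw [h1]; constructor <;> linarith [arg_le_pi τ, Real.pi_pos])]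
  ring_nf

/-- The transformation of the theta vector of index `1` under `τ ↦ -1/τ`. -/
lemma thetaJ_one_zero_S (hτ : 0 < τ.im) (z : ℂ) :
    thetaJ 1 0 (-1 / τ) (z / τ) = (-I / 2) ^ (1 / 2 : ℂ) * τ ^ (1 / 2 : ℂ) *
      cexp (2 * π * I * (z ^ 2 / τ)) * (thetaJ 1 0 τ z + thetaJ 1 1 τ z) := by
  have h0 : τ ≠ 0 := by
    rintro rfl
    simp at hτ
  have hne : (-I * (τ / 2)) ^ (1 / 2 : ℂ) ≠ 0 := by
    simp [cpow_eq_zero_iff, h0]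
  rw [← jacobiTheta₂_half hτ, jacobiTheta₂_functional_equation, ← neg_I_mul_half_cpow hτ,
    thetaJ_eq_jacobiTheta₂ one_ne_zero]
  have e1 : (↑(0 : ℕ) * (-1 / τ) + 2 * (1 : ℕ) * (z / τ) : ℂ) = z / (τ / 2) := by
    push_cast
    field_simp
    ring
  have e2 : (2 * (1 : ℕ) * (-1 / τ) : ℂ) = -1 / (τ / 2) := by
    push_cast
    field_simp
  have e : cexp (2 * π * I * (z ^ 2 / τ)) * cexp (-π * I * z ^ 2 / (τ / 2)) =
      cexp (2 * π * I * ((0 : ℕ) ^ 2 * (-1 / τ) / (4 * (1 : ℕ)) + (0 : ℕ) * (z / τ))) := by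
    rw [← Complex.exp_add]
    congr 1
    push_cast
    field_simp
    ring
  rw [e1, e2, ← e]
  field_simp

lemma thetaJ_one_one_S (hτ : 0 < τ.im) (z : ℂ) :
    thetaJ 1 1 (-1 / τ) (z / τ) = (-I / 2) ^ (1 / 2 : ℂ) * τ ^ (1 / 2 : ℂ) *
      cexp (2 * π * I * (z ^ 2 / τ)) * (thetaJ 1 0 τ z - thetaJ 1 1 τ z) := by
  have h0 : τ ≠ 0 := by
    rintro rfl
    simp at hτ
  have hne : (-I * (τ / 2)) ^ (1 / 2 : ℂ) ≠ 0 := by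
    simp [cpow_eq_zero_iff, h0]
  -- Periodicity replaces `z + 1/2` by `z - 1/2`, because `(z - 1/2)/(τ/2) = -1/τ + 2z/τ` is the
  -- argument occurring in `θ^J_{1,1}(-1/τ, z/τ)`.
  rw [← jacobiTheta₂_half_add_half hτ, ← neg_I_mul_half_cpow hτ,
    thetaJ_eq_jacobiTheta₂ one_ne_zero, show z + 1 / 2 = z - 1 / 2 + 1 by ring,
    jacobiTheta₂_add_left, jacobiTheta₂_functional_equation (z - 1 / 2)]
  have e1 : (↑(1 : ℕ) * (-1 / τ) + 2 * (1 : ℕ) * (z / τ) : ℂ) = (z - 1 / 2) / (τ / 2) := by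
    push_cast
    field_simp
    ring
  have e2 : (2 * (1 : ℕ) * (-1 / τ) : ℂ) = -1 / (τ / 2) := by
    push_cast
    field_simp
  have e : cexp (2 * π * I * (z ^ 2 / τ)) * cexp (-π * I * (z - 1 / 2) ^ 2 / (τ / 2)) =
      cexp (2 * π * I * ((1 : ℕ) ^ 2 * (-1 / τ) / (4 * (1 : ℕ)) + (1 : ℕ) * (z / τ))) := by
    rw [← Complex.exp_add]
    congr 1
    push_cast
    field_simp
    ring
  rw [e1, e2, ← e]
  field_simp

/-- The theta constants as exponential series. -/
lemma hasSum_theta (hm : m ≠ 0) (r : ℕ) (hτ : 0 < τ.im) :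
    HasSum (fun n : ℤ ↦ (1 : ℂ) * cexp (I * (2 * π * m * (n + r / (2 * m)) ^ 2 : ℝ) * τ))
      (theta m r τ) := by
  refine (hasSum_thetaJ hm r hτ 0).congr_fun fun n ↦ ?_
  rw [one_mul]
  push_cast
  ring_nf

lemma hasSum_deriv_theta (hm : m ≠ 0) (r : ℕ) (hτ : 0 < τ.im) :
    HasSum (fun n : ℤ ↦ 1 * (I * (2 * π * m * (n + r / (2 * m)) ^ 2 : ℝ)) *
      cexp (I * (2 * π * m * (n + r / (2 * m)) ^ 2 : ℝ) * τ)) (deriv (theta m r) τ) := by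
  have h := hasSum_deriv_tsum_cexp (c := fun _ : ℤ ↦ 1)
    (y := fun n : ℤ ↦ (2 * π * m * (n + r / (2 * m)) ^ 2 : ℝ)) (fun n _ ↦ by positivity)
    (fun w hw ↦ (hasSum_theta hm r hw).summable) hτ
  have hev : (fun w ↦ ∑' n : ℤ, 1 * cexp (I * (2 * π * m * (n + r / (2 * m)) ^ 2 : ℝ) * w)) =ᶠ[𝓝 τ]
      theta m r := by
    filter_upwards [(isOpen_lt continuous_const Complex.continuous_im).mem_nhds hτ] with w hw using
      (hasSum_theta hm r hw).tsum_eq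
  rwa [hev.deriv_eq] at h

/-- The heat equation at `z = 0`. -/
lemma iteratedDeriv_two_thetaJ (hm : m ≠ 0) (r : ℕ) (hτ : 0 < τ.im) :
    iteratedDeriv 2 (fun z ↦ thetaJ m r τ z) 0 = 8 * π * I * m * deriv (theta m r) τ := by
  have hm' : (m : ℝ) ≠ 0 := mod_cast hm
  have hz (z : ℂ) : HasSum (fun n : ℤ ↦ cexp (I * (2 * π * m * (n + r / (2 * m)) ^ 2 : ℝ) * τ) *
      cexp (I * (4 * π * m * (n + r / (2 * m)) : ℝ) * z)) (thetaJ m r τ z) := by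
    convert! hasSum_thetaJ hm r hτ z using 2 with n
    rw [← Complex.exp_add]
    push_cast
    ring_nf
  have h := hasSum_iteratedDeriv_two_tsum_cexp fun z ↦ (hz z).summable
  simp only [fun z ↦ (hz z).tsum_eq] at h
  refine h.unique ?_
  convert! (hasSum_deriv_theta hm r hτ).mul_left (8 * π * I * m) using 2 with n
  push_cast
  linear_combination (-16 * π ^ 2 * m ^ 2 * ((n : ℂ) + r / (2 * m)) ^ 2 *
    cexp (I * (2 * π * m * (n + r / (2 * m)) ^ 2) * τ)) * I_sq

lemma hasSum_fourier_thetaJ (hm : m ≠ 0) (r : ℕ) (hτ : 0 < τ.im) (b : ℕ) (t : ℝ) :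
    HasSum (fun n : ℤ ↦ cexp (2 * π * I * ((2 * m * n + r) ^ 2 * τ / (4 * m))) *
      cexp (2 * π * I * ((((2 * m * n + r) * b : ℤ) : ℂ) * (t : ℂ)))) (thetaJ m r τ (b * t)) := by
  have hm' : (m : ℂ) ≠ 0 := mod_cast hm
  convert! hasSum_thetaJ hm r hτ (b * t) using 2 with n
  rw [← Complex.exp_add]
  congr 1
  push_cast
  field_simp
  ring

lemma hasSum_fourierMode_thetaJ (hm : m ≠ 0) (r : ℕ) (hτ : 0 < τ.im) (b : ℕ) (a : ℤ) :
    HasSum (fun n : ℤ ↦ if (2 * m * n + r) * b = a then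
        cexp (2 * π * I * ((2 * m * n + r) ^ 2 * τ / (4 * m))) else 0)
      (fourierMode a fun z ↦ thetaJ m r τ (b * z)) :=
  hasSum_fourierMode (fun t ↦ hasSum_fourier_thetaJ hm r hτ b t) a

end Theta

/-! ### The automorphy factor -/

lemma autFactor_eq_denom (γ : SL(2, ℤ)) (τ : ℍ) : autFactor γ τ = denom γ τ := by
  simp [autFactor, ModularGroup.denom_apply]

lemma autFactor_ne_zero (γ : SL(2, ℤ)) (τ : ℍ) : autFactor γ τ ≠ 0 := by
  rw [autFactor_eq_denom]
  exact denom_ne_zero _ τ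

lemma coe_smul_eq (γ : SL(2, ℤ)) (τ : ℍ) :
    ((γ • τ : ℍ) : ℂ) = ((γ 0 0 : ℂ) * τ + γ 0 1) / autFactor γ τ := by
  rw [coe_specialLinearGroup_apply]
  simp [autFactor]

lemma det_eq_one (γ : SL(2, ℤ)) : (γ 0 0 : ℂ) * γ 1 1 - γ 0 1 * γ 1 0 = 1 := by
  have := γ.det_coe
  rw [Matrix.det_fin_two] at this
  exact_mod_cast this

lemma mul_apply_one_zero (γ δ : SL(2, ℤ)) :
    (γ * δ) 1 0 = γ 1 0 * δ 0 0 + γ 1 1 * δ 1 0 := by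
  simp [Matrix.SpecialLinearGroup.coe_mul, Matrix.mul_apply, Fin.sum_univ_two]

lemma mul_apply_one_one (γ δ : SL(2, ℤ)) :
    (γ * δ) 1 1 = γ 1 0 * δ 0 1 + γ 1 1 * δ 1 1 := by
  simp [Matrix.SpecialLinearGroup.coe_mul, Matrix.mul_apply, Fin.sum_univ_two]

lemma autFactor_mul (γ δ : SL(2, ℤ)) (τ : ℍ) :
    autFactor (γ * δ) τ = autFactor γ (δ • τ) * autFactor δ τ := by
  have h := autFactor_ne_zero δ τ
  rw [autFactor, autFactor, mul_apply_one_zero, mul_apply_one_one, coe_smul_eq]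
  field_simp
  simp only [autFactor]
  push_cast
  ring

lemma jacobi_exponent_mul (γ δ : SL(2, ℤ)) (τ : ℍ) (z : ℂ) :
    ((γ * δ) 1 0 : ℂ) * z ^ 2 / autFactor (γ * δ) τ =
      (γ 1 0 : ℂ) * (z / autFactor δ τ) ^ 2 / autFactor γ (δ • τ) +
        (δ 1 0 : ℂ) * z ^ 2 / autFactor δ τ := by
  have h := autFactor_ne_zero δ τ
  have h' := autFactor_ne_zero γ (δ • τ)
  have e := autFactor_mul γ δ τ
  have hd := det_eq_one δ
  have key : ((γ * δ) 1 0 : ℂ) * autFactor δ τ = γ 1 0 + δ 1 0 * autFactor (γ * δ) τ := by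
    simp only [autFactor, mul_apply_one_zero, mul_apply_one_one]
    push_cast
    linear_combination (γ 1 0 : ℂ) * hd
  rw [e] at key ⊢
  field_simp
  linear_combination z ^ 2 * key

lemma slash_apply_autFactor (f : ℍ → ℂ) (k : ℤ) (g : SL(2, ℤ)) (τ : ℍ) :
    (f ∣[k] g) τ = f (g • τ) * autFactor g τ ^ (-k) := by
  rw [SL_slash_apply, autFactor_eq_denom]

/-- For `c = 0` the factor is constant. Otherwise its imaginary part never vanishes, so it avoids
the branch cut. -/
lemma continuous_autFactor_cpow (γ : SL(2, ℤ)) :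
    Continuous fun τ : ℍ ↦ autFactor γ τ ^ (1 / 2 : ℂ) := by
  rcases eq_or_ne (γ 1 0) 0 with h | h
  · simp only [autFactor, h]
    simpa using continuous_const
  · refine continuous_iff_continuousAt.2 fun τ ↦ ?_
    have h1 : Continuous fun τ : ℍ ↦ autFactor γ τ := by
      unfold autFactor
      fun_prop
    refine h1.continuousAt.cpow continuousAt_const (mem_slitPlane_iff.2 (Or.inr ?_))
    simp only [autFactor, add_im, mul_im, intCast_im, intCast_re, zero_mul, add_zero]
    exact mul_ne_zero (mod_cast h) τ.im_ne_zero

lemma cpow_half_sq (w : ℂ) : (w ^ (1 / 2 : ℂ)) ^ 2 = w := by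
  rw [← cpow_nat_mul]
  norm_num

lemma cpow_half_ne_zero {w : ℂ} (hw : w ≠ 0) : w ^ (1 / 2 : ℂ) ≠ 0 := by
  simp [cpow_eq_zero_iff, hw]

/-- The square root of the automorphy factor is a cocycle up to a sign. -/
lemma exists_autFactor_mul_cpow (γ δ : SL(2, ℤ)) :
    ∃ ε : ℂ, ε ^ 2 = 1 ∧ ∀ τ : ℍ, autFactor (γ * δ) τ ^ (1 / 2 : ℂ) =
      ε * (autFactor γ (δ • τ) ^ (1 / 2 : ℂ) * autFactor δ τ ^ (1 / 2 : ℂ)) := by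
  have hcont : Continuous fun τ : ℍ ↦ δ • τ :=
    continuous_const_smul (δ : GL (Fin 2) ℝ)
  have h := (isPreconnected_univ (α := ℍ)).eq_or_eq_neg_of_sq_eq
    (f := fun τ ↦ autFactor (γ * δ) τ ^ (1 / 2 : ℂ))
    (g := fun τ ↦ autFactor γ (δ • τ) ^ (1 / 2 : ℂ) * autFactor δ τ ^ (1 / 2 : ℂ))
    (continuous_autFactor_cpow _).continuousOn
    (((continuous_autFactor_cpow γ).comp hcont).mul (continuous_autFactor_cpow δ)).continuousOn
    (fun τ _ ↦ by
      simp only [Pi.pow_apply, mul_pow, cpow_half_sq, autFactor_mul])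
    (fun {τ} _ ↦ mul_ne_zero (cpow_half_ne_zero (autFactor_ne_zero _ _))
      (cpow_half_ne_zero (autFactor_ne_zero _ _)))
  rcases h with h | h
  · exact ⟨1, by simp, fun τ ↦ by simpa using h (Set.mem_univ τ)⟩
  · exact ⟨-1, by simp, fun τ ↦ by simpa using h (Set.mem_univ τ)⟩

/-! ### The theta multiplier -/

/-- Multipliers compose up to the sign of the square root. In index 1 the matrices are 2×2, so the
sign disappears from the determinant. -/
lemma IsThetaMultiplier.mul {m : ℕ} {γ δ : SL(2, ℤ)} {U V : Matrix (Fin (2 * m)) (Fin (2 * m)) ℂ}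
    (hU : IsThetaMultiplier m γ U) (hV : IsThetaMultiplier m δ V) :
    ∃ ε : ℂ, ε ^ 2 = 1 ∧ IsThetaMultiplier m (γ * δ) (ε • (U * V)) := by
  obtain ⟨ε, hε, h⟩ := exists_autFactor_mul_cpow γ δ
  refine ⟨ε, hε, fun τ z r ↦ ?_⟩
  have e : z / autFactor (γ * δ) τ = z / autFactor δ τ / autFactor γ (δ • τ) := by
    rw [autFactor_mul, div_div, mul_comm]
  rw [mul_smul, e, hU, jacobi_exponent_mul, h, mul_add, Complex.exp_add]
  simp only [hV τ z, Matrix.smul_apply, Matrix.mul_apply, smul_eq_mul, Finset.mul_sum,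
    Finset.sum_mul]
  rw [Finset.sum_comm]
  refine Finset.sum_congr rfl fun s _ ↦ Finset.sum_congr rfl fun t _ ↦ ?_
  linear_combination (-(cexp (2 * π * I * m * (γ 1 0 * (z / autFactor δ τ) ^ 2 /
    autFactor γ (δ • τ))) * cexp (2 * π * I * m * (δ 1 0 * z ^ 2 / autFactor δ τ)) *
    (autFactor γ (δ • τ) ^ (1 / 2 : ℂ) * autFactor δ τ ^ (1 / 2 : ℂ)) * U r t * V t s *
    thetaJ m s τ z)) * hε

lemma isThetaMultiplier_one_iff {γ : SL(2, ℤ)} {U : Matrix (Fin (2 * 1)) (Fin (2 * 1)) ℂ} :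
    IsThetaMultiplier 1 γ U ↔ ∀ (τ : ℍ) (z : ℂ),
      thetaJ 1 0 ((γ • τ : ℍ) : ℂ) (z / autFactor γ τ) =
        cexp (2 * π * I * ((γ 1 0 : ℂ) * z ^ 2 / autFactor γ τ)) * autFactor γ τ ^ (1 / 2 : ℂ) *
          (U 0 0 * thetaJ 1 0 τ z + U 0 1 * thetaJ 1 1 τ z) ∧
      thetaJ 1 1 ((γ • τ : ℍ) : ℂ) (z / autFactor γ τ) =
        cexp (2 * π * I * ((γ 1 0 : ℂ) * z ^ 2 / autFactor γ τ)) * autFactor γ τ ^ (1 / 2 : ℂ) *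
          (U 1 0 * thetaJ 1 0 τ z + U 1 1 * thetaJ 1 1 τ z) := by
  simp only [IsThetaMultiplier, Nat.cast_one, mul_one]
  refine forall₂_congr fun τ z ↦ ?_
  exact Fin.forall_fin_two.trans (by simp [Fin.sum_univ_two])

lemma isThetaMultiplier_T_zpow (n : ℤ) :
    IsThetaMultiplier 1 (ModularGroup.T ^ n) !![1, 0; 0, cexp (2 * π * I * (n / 4))] := by
  refine isThetaMultiplier_one_iff.2 fun τ z ↦ ?_
  have e : ((ModularGroup.T ^ n • τ : ℍ) : ℂ) = τ + n := by
    rw [modular_T_zpow_smul, coe_vadd]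
    push_cast
    ring
  have ej : autFactor (ModularGroup.T ^ n) τ = 1 := by
    simp [autFactor, ModularGroup.coe_T_zpow]
  rw [e, ej, thetaJ_one_zero_add_intCast, thetaJ_one_one_add_intCast]
  simp [ModularGroup.coe_T_zpow]

lemma isThetaMultiplier_S : IsThetaMultiplier 1 ModularGroup.S
    ((-I / 2) ^ (1 / 2 : ℂ) • !![1, 1; 1, -1]) := by
  refine isThetaMultiplier_one_iff.2 fun τ z ↦ ?_
  have e : ((ModularGroup.S • τ : ℍ) : ℂ) = -1 / τ := by
    rw [modular_S_smul]
    simp [neg_div, inv_neg]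
  have ej : autFactor ModularGroup.S τ = τ := by
    simp [autFactor, ModularGroup.S]
  rw [e, ej, thetaJ_one_zero_S τ.im_pos, thetaJ_one_one_S τ.im_pos]
  constructor <;> simp [ModularGroup.S] <;> ring

/-- `S` and the powers of `T` have explicit multipliers with determinant of absolute value 1, and
both properties pass to products. Only products are available, so inverses of generators are
rewritten, with `S⁻¹ = S³`. -/
lemma exists_isThetaMultiplier (γ : SL(2, ℤ)) :
    ∃ U, IsThetaMultiplier 1 γ U ∧ ‖U.det‖ = 1 := by
  have hmul {γ δ : SL(2, ℤ)} (h1 : ∃ U, IsThetaMultiplier 1 γ U ∧ ‖U.det‖ = 1)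
      (h2 : ∃ U, IsThetaMultiplier 1 δ U ∧ ‖U.det‖ = 1) :
      ∃ U, IsThetaMultiplier 1 (γ * δ) U ∧ ‖U.det‖ = 1 := by
    obtain ⟨U, hU, hU'⟩ := h1
    obtain ⟨V, hV, hV'⟩ := h2
    obtain ⟨ε, hε, h⟩ := hU.mul hV
    refine ⟨_, h, ?_⟩
    rw [Matrix.det_smul, Matrix.det_mul]
    simp [hU', hV', hε]
  have hT (n : ℤ) : ∃ U, IsThetaMultiplier 1 (ModularGroup.T ^ n) U ∧ ‖U.det‖ = 1 := by
    refine ⟨_, isThetaMultiplier_T_zpow n, ?_⟩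
    rw [Matrix.det_fin_two_of, show 2 * π * I * (n / 4 : ℂ) = ((2 * π * (n / 4) : ℝ) : ℂ) * I by
      push_cast; ring]
    simp [norm_exp_ofReal_mul_I, -ofReal_mul, -ofReal_div]
  have hS : ∃ U, IsThetaMultiplier 1 ModularGroup.S U ∧ ‖U.det‖ = 1 := by
    refine ⟨_, isThetaMultiplier_S, ?_⟩
    rw [Matrix.det_smul, Matrix.det_fin_two_of]
    simp
    norm_num
  have hmem : γ ∈ Submonoid.closure
      (({ModularGroup.S, ModularGroup.T} : Set SL(2, ℤ)) ∪ {ModularGroup.S, ModularGroup.T}⁻¹) := by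
    rw [← Subgroup.closure_toSubmonoid, SpecialLinearGroup.SL2Z_generators]
    trivial
  induction hmem using Submonoid.closure_induction with
  | mem x hx =>
    simp only [Set.mem_union, Set.mem_insert_iff, Set.mem_singleton_iff, Set.mem_inv] at hx
    rcases hx with (rfl | rfl) | h | h
    · exact hS
    · simpa using hT 1
    · have : x = ModularGroup.S * (ModularGroup.S * ModularGroup.S) := by
        rw [← inv_inj, h]
        decide
      rw [this]
      exact hmul hS (hmul hS hS)
    · have : x = ModularGroup.T ^ (-1 : ℤ) := by
        rw [zpow_neg_one, ← h, inv_inv]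
      rw [this]
      exact hT _
  | one => simpa using hT 0
  | mul x y _ _ hx hy => exact hmul hx hy

/-! ### Functions with the multiplier of `η ^ 6` -/

lemma tendsto_eta_mul_cexp :
    Tendsto (fun τ : ℍ ↦ ModularForm.eta τ ^ 6 * cexp (-(2 * π * I * (τ / 4)))) atImInfty (𝓝 1) := by
  have htprod : Tendsto (fun q : ℂ ↦ ∏' (n : ℕ), (1 - q ^ (n + 1))) (𝓝 0) (𝓝 1) := by
    have := tendsto_tprod_one_add_of_dominated_convergence (𝓕 := 𝓝 0) (g := 0)
      (f := fun (q : ℂ) (n : ℕ) ↦ -q ^ (n + 1)) (bound := fun n ↦ (1 / 2 : ℝ) ^ (n + 1))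
    simp only [Pi.zero_apply, norm_neg, norm_pow, add_zero, tprod_one] at this
    simp_rw [sub_eq_add_neg]
    refine this
      (by simpa only [pow_succ'] using (summable_geometric_of_abs_lt_one (by norm_num)).mul_left _)
      (fun k ↦ by simpa using ((continuous_pow (M := ℂ) (k + 1)).tendsto 0).neg) ?_
    filter_upwards [Metric.ball_mem_nhds (0 : ℂ) (by norm_num : (0 : ℝ) < 1 / 2)] with q hq k
    exact pow_le_pow_left₀ (norm_nonneg _) (mem_ball_zero_iff.mp hq).le _
  have h := ((htprod.comp (qParam_tendsto_atImInfty zero_lt_one)).pow 6)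
  rw [one_pow] at h
  refine h.congr fun τ ↦ ?_
  have e : Function.Periodic.qParam 24 (τ : ℂ) ^ 6 * cexp (-(2 * π * I * (τ / 4))) = 1 := by
    rw [Function.Periodic.qParam, ← Complex.exp_nat_mul, ← Complex.exp_add, Complex.exp_eq_one_iff]
    exact ⟨0, by push_cast; ring⟩
  simp only [Function.comp_apply, ModularForm.eta, eta_q]
  linear_combination (-(∏' n : ℕ, (1 - Function.Periodic.qParam 1 (τ : ℂ) ^ (n + 1))) ^ 6) * e

/-- The range is connected and consists of roots of one polynomial, hence is a point. -/
lemma eq_const_of_pow_eq {X : Type*} [TopologicalSpace X] [PreconnectedSpace X] {f : X → ℂ}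
    (hf : Continuous f) {n : ℕ} (hn : 0 < n) {c : ℂ} (h : ∀ x, f x ^ n = c) (x y : X) :
    f x = f y := by
  have hfin : (Set.range f).Finite := by
    refine (Polynomial.nthRoots n c).toFinset.finite_toSet.subset ?_
    rintro _ ⟨x, rfl⟩
    simpa [Polynomial.mem_nthRoots hn] using h x
  exact hfin.countable.isTotallyDisconnected _ subset_rfl (isPreconnected_range hf) ⟨x, rfl⟩ ⟨y, rfl⟩

/-- The hypotheses make `V⁴` a level one cusp form of weight 12, hence a multiple of `Δ = η²⁴`. So
`(V/η⁶)⁴` is constant, `V/η⁶` is constant by connectedness, and its limit at infinity is `L`. -/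
theorem eq_const_mul_eta_pow_six {V : ℍ → ℂ} (hV : MDiff V)
    (hT : ∀ τ, V (ModularGroup.T • τ) = I * V τ)
    (hS : ∀ τ, V (ModularGroup.S • τ) = I * τ ^ 3 * V τ) {L : ℂ}
    (hL : Tendsto (fun τ : ℍ ↦ V τ * cexp (-(2 * π * I * (τ / 4)))) atImInfty (𝓝 L)) (τ : ℍ) :
    V τ = L * ModularForm.eta τ ^ 6 := by
  have hV' : DifferentiableOn ℂ (V ∘ ofComplex) {z | 0 < z.im} := UpperHalfPlane.mdifferentiable_iff.1 hV
  have hT' : (V ^ 4) ∣[(12 : ℤ)] ModularGroup.T = V ^ 4 := by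
    ext τ
    have ej : autFactor ModularGroup.T τ = 1 := by simp [autFactor, ModularGroup.T]
    rw [slash_apply_autFactor, ej, Pi.pow_apply, Pi.pow_apply, hT, mul_pow, I_pow_four]
    simp
  have hS' : (V ^ 4) ∣[(12 : ℤ)] ModularGroup.S = V ^ 4 := by
    ext τ
    have ej : autFactor ModularGroup.S τ = τ := by simp [autFactor, ModularGroup.S]
    have h0 := τ.ne_zero
    rw [slash_apply_autFactor, ej, Pi.pow_apply, Pi.pow_apply, hS, mul_pow, mul_pow, I_pow_four]
    rw [zpow_neg, show (12 : ℤ) = (12 : ℕ) from rfl, zpow_natCast]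
    field_simp
  have hdiff : MDiff (V ^ 4) := UpperHalfPlane.mdifferentiable_iff.2 (hV'.pow 4)
  have hzero : IsZeroAtImInfty (V ^ 4) := by
    have h1 := (hL.pow 4).mul (qParam_tendsto_atImInfty zero_lt_one)
    rw [mul_zero] at h1
    refine h1.congr fun τ ↦ ?_
    have e : cexp (-(2 * π * I * (τ / 4))) ^ 4 * Function.Periodic.qParam 1 (τ : ℂ) = 1 := by
      rw [Function.Periodic.qParam, ← Complex.exp_nat_mul, ← Complex.exp_add,
        Complex.exp_eq_one_iff]
      exact ⟨0, by push_cast; ring⟩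
    rw [mul_pow, mul_assoc, e, mul_one, Pi.pow_apply]
  let F : CuspForm 𝒮ℒ 12 :=
    { toFun := V ^ 4
      slash_action_eq' := by
        rintro A ⟨A, rfl⟩
        exact SlashInvariantForm.slash_action_generators_SL2Z hS' hT' A
      holo' := hdiff
      zero_at_cusps' := fun hc ↦ by
        rw [Subgroup.IsArithmetic.isCusp_iff_isCusp_SL2Z] at hc
        rw [OnePoint.isZeroAt_iff_forall_SL2Z hc]
        intro γ _
        rw [SlashInvariantForm.slash_action_generators_SL2Z hS' hT']
        exact hzero }
  obtain ⟨c, hc⟩ := CuspForm.exists_smul_discriminant_of_weight_eq_twelve F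
  have hne (τ : ℍ) : ModularForm.eta τ ^ 6 ≠ 0 := pow_ne_zero _ (eta_ne_zero τ.2)
  have hpow (τ : ℍ) : (V τ / ModularForm.eta τ ^ 6) ^ 4 = c := by
    have := congrArg (fun f : CuspForm 𝒮ℒ 12 ↦ f τ) hc
    have h2 : c * ModularForm.eta τ ^ 24 = V τ ^ 4 := this
    have h3 : ModularForm.eta τ ≠ 0 := eta_ne_zero τ.2
    rw [div_pow, ← h2]
    field_simp
  have hcont : Continuous fun τ : ℍ ↦ V τ / ModularForm.eta τ ^ 6 := by
    refine hV.continuous.div (Continuous.pow ?_ 6) hne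
    refine continuous_iff_continuousAt.2 fun τ ↦ ?_
    exact (differentiableAt_eta_of_mem_upperHalfPlaneSet τ.2).continuousAt.comp
      (f := fun τ : ℍ ↦ (τ : ℂ)) UpperHalfPlane.continuous_coe.continuousAt
  have hlim : Tendsto (fun τ : ℍ ↦ V τ / ModularForm.eta τ ^ 6) atImInfty (𝓝 L) := by
    have := hL.div tendsto_eta_mul_cexp one_ne_zero
    rw [div_one] at this
    refine this.congr fun τ ↦ ?_
    rw [Pi.div_apply, mul_div_mul_right _ _ (Complex.exp_ne_zero _)]
  have hc : (fun τ' : ℍ ↦ V τ' / ModularForm.eta τ' ^ 6) = fun _ ↦ V τ / ModularForm.eta τ ^ 6 :=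
    funext fun τ' ↦ eq_const_of_pow_eq hcont (by norm_num) hpow τ' τ
  rw [hc] at hlim
  rw [← tendsto_nhds_unique tendsto_const_nhds hlim, div_mul_cancel₀ _ (hne τ)]

/-! ### The form `θ_{1,1}(τ) θ^J_{1,0}(τ,z) - θ_{1,0}(τ) θ^J_{1,1}(τ,z)` -/

lemma iteratedDeriv_two_comp_div {F : ℂ → ℂ} (hF : Differentiable ℂ F) (j : ℂ) :
    iteratedDeriv 2 (fun z ↦ F (z / j)) 0 = iteratedDeriv 2 F 0 / j ^ 2 := by
  have h := iteratedDeriv_comp_const_mul (n := 2) (hF.contDiff (n := 2)) j⁻¹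
  have h' := congrFun h 0
  simp only [mul_zero] at h'
  rw [div_eq_inv_mul, ← inv_pow, ← h']
  congr 1
  ext z
  rw [div_eq_inv_mul]

lemma iteratedDeriv_two_cexp_mul {F : ℂ → ℂ} (hF : Differentiable ℂ F) (b : ℂ) :
    iteratedDeriv 2 (fun z ↦ cexp (b * z ^ 2) * F z) 0 = 2 * b * F 0 + iteratedDeriv 2 F 0 := by
  have hF' : Differentiable ℂ (deriv F) := hF.deriv
  have h1 : deriv (fun z ↦ cexp (b * z ^ 2) * F z) =
      fun z ↦ cexp (b * z ^ 2) * (2 * b * z * F z + deriv F z) := by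
    ext z
    have e : HasDerivAt (fun z : ℂ ↦ cexp (b * z ^ 2)) (cexp (b * z ^ 2) * (b * (2 * z))) z := by
      simpa using (((hasDerivAt_id' z).pow 2).const_mul b).cexp
    refine ((e.mul (hF z).hasDerivAt).congr_deriv ?_).deriv
    ring
  rw [iteratedDeriv_succ, iteratedDeriv_one, h1, iteratedDeriv_succ, iteratedDeriv_one]
  have e : HasDerivAt (fun z : ℂ ↦ cexp (b * z ^ 2)) (cexp (b * 0 ^ 2) * (b * (2 * 0))) 0 := by
    simpa using (((hasDerivAt_id' (0 : ℂ)).pow 2).const_mul b).cexp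
  have e2 := (((hasDerivAt_id' (0 : ℂ)).const_mul (2 * b)).mul (hF 0).hasDerivAt).add
    (hF' 0).hasDerivAt
  have e3 := e.mul e2
  rw [show (fun z ↦ cexp (b * z ^ 2) * (2 * b * z * F z + deriv F z)) =
    (fun z : ℂ ↦ cexp (b * z ^ 2)) * (((fun z ↦ 2 * b * z) * F) + deriv F) from rfl, e3.deriv]
  simp

/-- The form `θ_{1,1}(τ) θ^J_{1,0}(τ,z) - θ_{1,0}(τ) θ^J_{1,1}(τ,z)`, of weight and index `1`. -/
def thetaWedge (τ z : ℂ) : ℂ := theta 1 1 τ * thetaJ 1 0 τ z - theta 1 0 τ * thetaJ 1 1 τ z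

lemma thetaWedge_zero (τ : ℂ) : thetaWedge τ 0 = 0 := by
  simp [thetaWedge, theta, mul_comm]

lemma thetaWedge_mul (m : ℕ) (hm : m ≠ 0) (τ z : ℂ) :
    thetaWedge (m * τ) (m * z) = theta m m τ * thetaJ m 0 τ z - theta m 0 τ * thetaJ m m τ z := by
  simp only [thetaWedge, theta, thetaJ_zero_eq m, thetaJ_self_eq hm, mul_zero]

lemma thetaWedge_add_intCast (n : ℤ) (τ z : ℂ) :
    thetaWedge (τ + n) z = cexp (2 * π * I * (n / 4)) * thetaWedge τ z := by
  simp only [thetaWedge, theta, thetaJ_one_zero_add_intCast, thetaJ_one_one_add_intCast]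
  ring

lemma differentiable_thetaWedge {τ : ℂ} (hτ : 0 < τ.im) : Differentiable ℂ (thetaWedge τ) := by
  intro z
  exact ((differentiableAt_thetaJ_snd one_ne_zero 0 hτ z).const_mul _).sub
    ((differentiableAt_thetaJ_snd one_ne_zero 1 hτ z).const_mul _)

/-- This is the determinant of the theta vectors at `(τ,0)` and `(τ,z)`, so the multiplier
contributes `U.det`. The two factors `(cτ+d)^{1/2}` multiply to `cτ+d`, which removes the square
root. -/
lemma thetaWedge_smul {γ : SL(2, ℤ)} {U : Matrix (Fin (2 * 1)) (Fin (2 * 1)) ℂ}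
    (hU : IsThetaMultiplier 1 γ U) (τ : ℍ) (z : ℂ) :
    thetaWedge ((γ • τ : ℍ) : ℂ) (z / autFactor γ τ) =
      autFactor γ τ * cexp (2 * π * I * ((γ 1 0 : ℂ) * z ^ 2 / autFactor γ τ)) * U.det *
        thetaWedge τ z := by
  obtain ⟨h1, h2⟩ := isThetaMultiplier_one_iff.1 hU τ z
  obtain ⟨h3, h4⟩ := isThetaMultiplier_one_iff.1 hU τ 0
  have hdet : U.det = U 0 0 * U 1 1 - U 0 1 * U 1 0 := Matrix.det_fin_two U
  simp only [zero_div, ne_eq, OfNat.ofNat_ne_zero, not_false_eq_true, zero_pow, mul_zero,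
    Complex.exp_zero, one_mul] at h3 h4
  simp only [thetaWedge, theta]
  rw [h1, h2, h3, h4, hdet]
  conv_rhs => enter [1, 1, 1]; rw [← cpow_half_sq (autFactor γ τ)]
  ring

lemma iteratedDeriv_two_thetaWedge (τ : ℍ) :
    iteratedDeriv 2 (thetaWedge τ) 0 = 8 * π * I * xiStar 1 τ := by
  have hd (r : ℕ) : ContDiffAt ℂ 2 (fun z ↦ thetaJ 1 r τ z) 0 :=
    (Differentiable.contDiff fun z ↦
      differentiableAt_thetaJ_snd one_ne_zero r τ.im_pos z).contDiffAt
  have e : thetaWedge τ = (fun z ↦ theta 1 1 τ * thetaJ 1 0 τ z) -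
    (fun z ↦ theta 1 0 τ * thetaJ 1 1 τ z) := rfl
  rw [e, iteratedDeriv_sub (contDiffAt_const.mul (hd 0)) (contDiffAt_const.mul (hd 1)),
    iteratedDeriv_const_mul_field, iteratedDeriv_const_mul_field,
    iteratedDeriv_two_thetaJ one_ne_zero 0 τ.im_pos,
    iteratedDeriv_two_thetaJ one_ne_zero 1 τ.im_pos, xiStar]
  push_cast
  ring

/-- Second `z`-derivative at `0` of the law of `thetaWedge`. The exponential contributes nothing
because the wedge vanishes at `z = 0`, and each of the two derivatives brings a factor `cτ+d`. -/
lemma xiStar_one_smul {γ : SL(2, ℤ)} {U : Matrix (Fin (2 * 1)) (Fin (2 * 1)) ℂ}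
    (hU : IsThetaMultiplier 1 γ U) (τ : ℍ) :
    xiStar 1 (γ • τ) = U.det * autFactor γ τ ^ 3 * xiStar 1 τ := by
  have hj := autFactor_ne_zero γ τ
  have h1 := iteratedDeriv_two_comp_div (differentiable_thetaWedge (γ • τ).im_pos) (autFactor γ τ)
  have h2 : (fun z ↦ thetaWedge ((γ • τ : ℍ) : ℂ) (z / autFactor γ τ)) = fun z ↦
      (autFactor γ τ * U.det) * (cexp (2 * π * I * (γ 1 0 : ℂ) / autFactor γ τ * z ^ 2) *
        thetaWedge τ z) := by
    ext z
    rw [thetaWedge_smul hU]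
    ring_nf
  rw [h2, iteratedDeriv_const_mul_field,
    iteratedDeriv_two_cexp_mul (differentiable_thetaWedge τ.im_pos), thetaWedge_zero,
    iteratedDeriv_two_thetaWedge, iteratedDeriv_two_thetaWedge] at h1
  have hpi : (8 * π * I : ℂ) ≠ 0 := by simp
  field_simp at h1
  apply mul_left_cancel₀ hpi
  linear_combination -(π * I) * h1

lemma differentiableOn_theta (m : ℕ) (hm : m ≠ 0) (r : ℕ) :
    DifferentiableOn ℂ (theta m r) {w | 0 < w.im} :=
  fun _ hw ↦ (differentiableAt_theta hm r hw).differentiableWithinAt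

lemma mdifferentiable_of_differentiableOn {F : ℂ → ℂ} (hF : DifferentiableOn ℂ F {w | 0 < w.im}) :
    MDiff (fun τ : ℍ ↦ F τ) := by
  refine UpperHalfPlane.mdifferentiable_iff.2 (hF.congr fun w hw ↦ ?_)
  simp [ofComplex_apply_of_im_pos hw]

lemma mdifferentiable_xiStar {m : ℕ} (hm : m ≠ 0) : MDiff (xiStar m) := by
  have hU : IsOpen {w : ℂ | 0 < w.im} := isOpen_lt continuous_const Complex.continuous_im
  exact mdifferentiable_of_differentiableOn
    (((differentiableOn_theta m hm m).mul ((differentiableOn_theta m hm 0).deriv hU)).sub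
    ((differentiableOn_theta m hm 0).mul ((differentiableOn_theta m hm m).deriv hU)))

/-! ### Behaviour of the theta constants at infinity -/

lemma one_le_sq_of_ne_zero {n : ℤ} (hn : n ≠ 0) : 1 ≤ n ^ 2 :=
  Int.add_one_le_iff.2 (sq_pos_iff.2 hn)

lemma tendsto_theta_one_zero : Tendsto (fun τ : ℍ ↦ theta 1 0 τ) atImInfty (𝓝 1) := by
  have h := tendsto_atImInfty_of_hasSum_cexp (δ := 2 * π) (by positivity) {0}
    (fun τ : ℍ ↦ hasSum_theta one_ne_zero 0 τ.im_pos) (by simp) (fun n hn _ ↦ ?_)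
  · simpa using h
  · have : (1 : ℝ) ≤ (n : ℝ) ^ 2 := mod_cast one_le_sq_of_ne_zero (by simpa using hn)
    simp
    nlinarith [Real.pi_pos]

lemma tendsto_deriv_theta_one_zero :
    Tendsto (fun τ : ℍ ↦ deriv (theta 1 0) τ) atImInfty (𝓝 0) := by
  have h := tendsto_atImInfty_of_hasSum_cexp (δ := 2 * π) (by positivity) {0}
    (fun τ : ℍ ↦ hasSum_deriv_theta one_ne_zero 0 τ.im_pos) (by simp) (fun n hn _ ↦ ?_)
  · simpa using h
  · have : (1 : ℝ) ≤ (n : ℝ) ^ 2 := mod_cast one_le_sq_of_ne_zero (by simpa using hn)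
    simp
    nlinarith [Real.pi_pos]

lemma two_pi_le_two_pi_mul (n : ℤ) (hn : n ∉ ({0, -1} : Finset ℤ)) :
    2 * π ≤ 2 * π * (n * (n + 1)) := by
  have : (1 : ℝ) ≤ n * (n + 1) := by
    simp only [Finset.mem_insert, Finset.mem_singleton, not_or] at hn
    have : 1 ≤ n * (n + 1) := by
      rcases lt_or_ge n 0 with h | h
      · nlinarith [show n ≤ -2 by omega]
      · nlinarith [show 1 ≤ n by omega]
    exact_mod_cast this
  nlinarith [Real.pi_pos]

lemma tendsto_theta_one_one :
    Tendsto (fun τ : ℍ ↦ theta 1 1 τ * cexp (-(2 * π * I * (τ / 4)))) atImInfty (𝓝 2) := by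
  have h := tendsto_atImInfty_of_hasSum_cexp (c := fun _ : ℤ ↦ 1)
    (y := fun n : ℤ ↦ 2 * π * (n * (n + 1))) (δ := 2 * π) (by positivity) {0, -1}
    (fun τ : ℍ ↦ ((hasSum_theta one_ne_zero 1 τ.im_pos).mul_right
      (cexp (-(2 * π * I * (τ / 4))))).congr_fun fun n ↦ ?_) (by simp)
    (fun n hn _ ↦ two_pi_le_two_pi_mul n hn)
  · simpa [one_add_one_eq_two] using h
  · conv_rhs => rw [mul_assoc, ← Complex.exp_add]
    push_cast
    ring_nf

lemma tendsto_deriv_theta_one_one :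
    Tendsto (fun τ : ℍ ↦ deriv (theta 1 1) τ * cexp (-(2 * π * I * (τ / 4)))) atImInfty
      (𝓝 (π * I)) := by
  have h := tendsto_atImInfty_of_hasSum_cexp (c := fun n : ℤ ↦ I * (2 * π * (n + 1 / 2) ^ 2))
    (y := fun n : ℤ ↦ 2 * π * (n * (n + 1))) (δ := 2 * π) (by positivity) {0, -1}
    (fun τ : ℍ ↦ ((hasSum_deriv_theta one_ne_zero 1 τ.im_pos).mul_right
      (cexp (-(2 * π * I * (τ / 4))))).congr_fun fun n ↦ ?_) (by simp)
    (fun n hn _ ↦ two_pi_le_two_pi_mul n hn)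
  · convert! h using 2
    rw [Finset.sum_pair (by norm_num)]
    push_cast
    ring
  · rw [mul_assoc (1 * _), ← Complex.exp_add]
    push_cast
    ring_nf

/-! ### Identities with `η⁶` and nonvanishing of the theta constants -/

lemma cexp_two_pi_I_div_four : cexp (2 * π * I * (1 / 4)) = I := by
  rw [show 2 * π * I * (1 / 4) = π / 2 * I by ring, Complex.exp_pi_div_two_mul_I]

lemma xiStar_one_eq (τ : ℍ) : xiStar 1 τ = -(π * I) * ModularForm.eta τ ^ 6 := by
  refine eq_const_mul_eta_pow_six (mdifferentiable_xiStar one_ne_zero) (fun τ ↦ ?_) (fun τ ↦ ?_) ?_ τ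
  · have h := xiStar_one_smul (isThetaMultiplier_T_zpow 1) τ
    have ej : autFactor ModularGroup.T τ = 1 := by simp [autFactor, ModularGroup.T]
    have hdet : (!![1, 0; 0, cexp (2 * π * I * ((1 : ℤ) / 4))]).det = I := by
      rw [Matrix.det_fin_two_of, Int.cast_one, cexp_two_pi_I_div_four]
      simp
    rw [zpow_one, ej] at h
    rw [h, show Matrix.det _ = I from hdet]
    simp
  · have h := xiStar_one_smul isThetaMultiplier_S τ
    have ej : autFactor ModularGroup.S τ = τ := by simp [autFactor, ModularGroup.S]
    have hdet : ((-I / 2) ^ (1 / 2 : ℂ) • !![1, 1; 1, -1]).det = I := by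
      rw [Matrix.det_smul, Matrix.det_fin_two_of, Fintype.card_fin, cpow_half_sq]
      ring
    rw [h, ej, show Matrix.det _ = I from hdet]
  · have h := (tendsto_theta_one_one.mul tendsto_deriv_theta_one_zero).sub
      (tendsto_theta_one_zero.mul tendsto_deriv_theta_one_one)
    rw [mul_zero, one_mul, zero_sub] at h
    refine h.congr fun τ ↦ ?_
    rw [xiStar]
    ring

/-- The sextic `xy(x⁴ - y⁴)` is semi-invariant under the substitutions induced by `T` and `S`: `y ↦
iy` multiplies it by `i`, and `(x, y) ↦ (x+y, x-y)` by `8`. Since it contains `x` and `y` as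
factors, the identity shows that neither theta constant vanishes. -/
lemma theta_one_zero_mul_theta_one_one (τ : ℍ) :
    theta 1 0 τ * theta 1 1 τ * (theta 1 0 τ ^ 4 - theta 1 1 τ ^ 4) =
      2 * ModularForm.eta τ ^ 6 := by
  have hx := differentiableOn_theta 1 one_ne_zero 0
  have hy := differentiableOn_theta 1 one_ne_zero 1
  refine eq_const_mul_eta_pow_six (V := fun τ ↦ theta 1 0 τ * theta 1 1 τ *
      (theta 1 0 τ ^ 4 - theta 1 1 τ ^ 4)) (mdifferentiable_of_differentiableOn
      ((hx.mul hy).mul ((hx.pow 4).sub (hy.pow 4)))) (fun τ ↦ ?_) (fun τ ↦ ?_) ?_ τ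
  · have e : ((ModularGroup.T • τ : ℍ) : ℂ) = τ + (1 : ℤ) := by
      rw [modular_T_smul, coe_vadd]
      push_cast
      ring
    simp only [theta, e, thetaJ_one_zero_add_intCast, thetaJ_one_one_add_intCast]
    rw [Int.cast_one, cexp_two_pi_I_div_four, mul_pow, I_pow_four]
    ring
  · have e : ((ModularGroup.S • τ : ℍ) : ℂ) = -1 / τ := by
      rw [modular_S_smul]
      simp [neg_div, inv_neg]
    have h0 := thetaJ_one_zero_S τ.im_pos 0
    have h1 := thetaJ_one_one_S τ.im_pos 0
    simp only [zero_div, ne_eq, OfNat.ofNat_ne_zero, not_false_eq_true, zero_pow, mul_zero,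
      Complex.exp_zero, mul_one] at h0 h1
    simp only [theta, e, h0, h1]
    set s := (-I / 2) ^ (1 / 2 : ℂ) * (τ : ℂ) ^ (1 / 2 : ℂ) with hs
    have hs2 : s ^ 2 = -I / 2 * τ := by rw [hs, mul_pow, cpow_half_sq, cpow_half_sq]
    have hs6 : s ^ 6 = I * τ ^ 3 / 8 := by
      rw [show s ^ 6 = (s ^ 2) ^ 3 by ring, hs2]
      linear_combination (-I * τ ^ 3 / 8) * I_sq
    set x := thetaJ 1 0 τ 0
    set y := thetaJ 1 1 τ 0
    linear_combination (8 * x * y * (x ^ 4 - y ^ 4)) * hs6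
  · have hy0 : Tendsto (fun τ : ℍ ↦ theta 1 1 τ) atImInfty (𝓝 0) := by
      have h := tendsto_atImInfty_of_hasSum_cexp (δ := π / 2) (by positivity) ∅
        (fun τ : ℍ ↦ hasSum_theta one_ne_zero 1 τ.im_pos) (by simp) (fun n _ _ ↦ ?_)
      · simpa using h
      · have : (1 : ℝ) ≤ (2 * n + 1) ^ 2 := by
          have : (1 : ℤ) ≤ (2 * n + 1) ^ 2 := one_le_sq_of_ne_zero (by omega)
          exact_mod_cast this
        push_cast
        nlinarith [Real.pi_pos]
    have h := (tendsto_theta_one_zero.mul tendsto_theta_one_one).mul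
      ((tendsto_theta_one_zero.pow 4).sub (hy0.pow 4))
    norm_num at h
    refine h.congr fun τ ↦ ?_
    ring

/-- The point `m τ` of the upper half-plane. -/
def scale (m : ℕ) (hm : m ≠ 0) (τ : ℍ) : ℍ := ⟨m * τ, by
  have : 0 < m := Nat.pos_of_ne_zero hm
  rw [← ofReal_natCast, im_ofReal_mul]
  exact mul_pos (mod_cast this) τ.im_pos⟩

lemma coe_scale (m : ℕ) (hm : m ≠ 0) (τ : ℍ) : (scale m hm τ : ℂ) = m * τ := rfl

lemma theta_zero_ne_zero {m : ℕ} (hm : m ≠ 0) (τ : ℍ) : theta m 0 τ ≠ 0 := by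
  have h := theta_one_zero_mul_theta_one_one (scale m hm τ)
  have h2 : ModularForm.eta (scale m hm τ) ≠ 0 := eta_ne_zero (scale m hm τ).2
  intro h0
  rw [theta, thetaJ_zero_eq, mul_zero, ← coe_scale m hm] at h0
  rw [theta, h0] at h
  simp [h2] at h

lemma theta_self_ne_zero {m : ℕ} (hm : m ≠ 0) (τ : ℍ) : theta m m τ ≠ 0 := by
  have h := theta_one_zero_mul_theta_one_one (scale m hm τ)
  have h2 : ModularForm.eta (scale m hm τ) ≠ 0 := eta_ne_zero (scale m hm τ).2
  intro h0
  rw [theta, thetaJ_self_eq hm, mul_zero, ← coe_scale m hm] at h0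
  rw [theta, theta, h0] at h
  simp [h2] at h

lemma xiStar_eq_mul_xiStar_one {m : ℕ} (hm : m ≠ 0) (τ : ℍ) :
    xiStar m τ = m * xiStar 1 (scale m hm τ) := by
  have h0 : theta m 0 = fun w ↦ theta 1 0 (m * w) := by
    ext w
    rw [theta, thetaJ_zero_eq, mul_zero, theta]
  have h1 : theta m m = fun w ↦ theta 1 1 (m * w) := by
    ext w
    rw [theta, thetaJ_self_eq hm, mul_zero, theta]
  rw [xiStar, h0, h1, deriv_comp_mul_left, deriv_comp_mul_left, xiStar, coe_scale]
  simp only [smul_eq_mul]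
  ring

theorem xiStar_eq {m : ℕ} (hm : m ≠ 0) (τ : ℍ) :
    xiStar m τ = -(π * I * m * ModularForm.eta (m * (τ : ℂ)) ^ 6) := by
  rw [xiStar_eq_mul_xiStar_one hm, xiStar_one_eq, coe_scale]
  ring

lemma xiStar_ne_zero {m : ℕ} (hm : m ≠ 0) (τ : ℍ) : xiStar m τ ≠ 0 := by
  have h2 : ModularForm.eta (m * τ) ≠ 0 := eta_ne_zero (scale m hm τ).2
  rw [xiStar_eq hm]
  simp [hm, h2]

/-- The second derivative at `0` is a nonzero multiple of `ξ*_1`. This permits cancelling the wedge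
from identities in `z`. -/
lemma exists_thetaWedge_ne_zero (τ : ℍ) : ∃ z, thetaWedge τ z ≠ 0 := by
  by_contra! h
  have h2 := iteratedDeriv_two_thetaWedge τ
  rw [show thetaWedge τ = fun _ ↦ 0 from funext h] at h2
  simp [xiStar_ne_zero one_ne_zero] at h2

/-! ### The operator `D₂` -/

/-- Joint holomorphy of a function on `ℍ × ℂ`. -/
def IsJointlyHolomorphic (φ : ℍ → ℂ → ℂ) : Prop :=
  DifferentiableOn ℂ (fun p : ℂ × ℂ ↦ φ (ofComplex p.1) p.2) {p | 0 < p.1.im}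

section Holomorphic

variable {φ ψ : ℍ → ℂ → ℂ}

lemma IsJointlyHolomorphic.differentiableAt (hφ : IsJointlyHolomorphic φ) {w : ℂ} (hw : 0 < w.im)
    (z : ℂ) : DifferentiableAt ℂ (fun p : ℂ × ℂ ↦ φ (ofComplex p.1) p.2) (w, z) :=
  DifferentiableOn.differentiableAt hφ
    ((isOpen_lt continuous_const (Complex.continuous_im.comp continuous_fst)).mem_nhds hw)

lemma IsJointlyHolomorphic.differentiable (hφ : IsJointlyHolomorphic φ) (τ : ℍ) :
    Differentiable ℂ (φ τ) := fun z ↦ by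
  have h := DifferentiableAt.comp z (f := fun z ↦ ((τ : ℂ), z))
    (g := fun p : ℂ × ℂ ↦ φ (ofComplex p.1) p.2) (hφ.differentiableAt τ.im_pos z) (by fun_prop)
  simpa [Function.comp_def] using h

lemma IsJointlyHolomorphic.differentiableAt_ofComplex (hφ : IsJointlyHolomorphic φ) (z : ℂ)
    {w : ℂ} (hw : 0 < w.im) : DifferentiableAt ℂ (fun w : ℂ ↦ φ (ofComplex w) z) w :=
  DifferentiableAt.comp w (f := fun w ↦ (w, z))
    (g := fun p : ℂ × ℂ ↦ φ (ofComplex p.1) p.2) (hφ.differentiableAt hw z) (by fun_prop)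

lemma heatOperator_add (k : ℕ) (a : ℂ) (hφ : IsJointlyHolomorphic φ)
    (hψ : IsJointlyHolomorphic ψ) :
    heatOperator k a (φ + ψ) = heatOperator k a φ + heatOperator k a ψ := by
  ext τ
  have h1 : (fun z : ℂ ↦ (φ + ψ) τ z) = φ τ + ψ τ := rfl
  have h2 : (fun w : ℂ ↦ (φ + ψ) (ofComplex w) 0) =
    (fun w : ℂ ↦ φ (ofComplex w) 0) + fun w : ℂ ↦ ψ (ofComplex w) 0 := rfl
  rw [heatOperator, h1, h2, deriv_add (hφ.differentiableAt_ofComplex 0 τ.im_pos)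
    (hψ.differentiableAt_ofComplex 0 τ.im_pos), iteratedDeriv_add
    ((hφ.differentiable τ).contDiff.contDiffAt) ((hψ.differentiable τ).contDiff.contDiffAt)]
  simp only [Pi.add_apply, heatOperator]
  ring

lemma heatOperator_smul (k : ℕ) (a c : ℂ) (φ : ℍ → ℂ → ℂ) :
    heatOperator k a (c • φ) = c • heatOperator k a φ := by
  ext τ
  have h1 : (fun z : ℂ ↦ (c • φ) τ z) = fun z ↦ c * φ τ z := rfl
  have h2 : (fun w : ℂ ↦ (c • φ) (ofComplex w) 0) = fun w : ℂ ↦ c * φ (ofComplex w) 0 := rfl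
  rw [heatOperator, h1, h2, deriv_const_mul_field, iteratedDeriv_const_mul_field, Pi.smul_apply,
    heatOperator, smul_eq_mul]
  ring

lemma heatOperator_of_apply_zero (k : ℕ) (a : ℂ) (h : ∀ τ, φ τ 0 = 0) (τ : ℍ) :
    heatOperator k a φ τ = k / (2 * π * I) * iteratedDeriv 2 (φ τ) 0 := by
  simp [heatOperator, h]

lemma hasDerivAt_jacobiSlash_zero (k : ℤ) (m : ℕ) (g : SL(2, ℤ)) (hφ : IsJointlyHolomorphic φ)
    (τ : ℍ) : HasDerivAt (fun w : ℂ ↦ jacobiSlash k m g φ (ofComplex w) 0)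
      (-k * autFactor g τ ^ (-k - 1) * g 1 0 * φ (g • τ) 0 + autFactor g τ ^ (-k) *
        (deriv (fun w : ℂ ↦ φ (ofComplex w) 0) (g • τ : ℍ) / autFactor g τ ^ 2)) τ := by
  have hj := autFactor_ne_zero g τ
  have hj' : (g 1 0 : ℂ) * τ + g 1 1 ≠ 0 := hj
  have hev : (fun w : ℂ ↦ jacobiSlash k m g φ (ofComplex w) 0) =ᶠ[𝓝 (τ : ℂ)] fun w ↦
      ((g 1 0 : ℂ) * w + g 1 1) ^ (-k) * (fun w : ℂ ↦ φ (ofComplex w) 0)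
        (((g 0 0 : ℂ) * w + g 0 1) / ((g 1 0 : ℂ) * w + g 1 1)) := by
    filter_upwards [(isOpen_lt continuous_const Complex.continuous_im).mem_nhds τ.im_pos] with w hw
    have e := coe_smul_eq g ⟨w, hw⟩
    simp only [autFactor] at e
    have e' : ofComplex (((g 0 0 : ℂ) * w + g 0 1) / ((g 1 0 : ℂ) * w + g 1 1)) =
        g • (⟨w, hw⟩ : ℍ) := by
      rw [← ofComplex_apply (g • (⟨w, hw⟩ : ℍ)), e]
    rw [e', jacobiSlash, ofComplex_apply_of_im_pos hw]
    simp [autFactor]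
  refine HasDerivAt.congr_of_eventuallyEq ?_ hev
  have h1 : HasDerivAt (fun w : ℂ ↦ (g 1 0 : ℂ) * w + g 1 1) (g 1 0) τ := by
    simpa using ((hasDerivAt_id' (τ : ℂ)).const_mul (g 1 0 : ℂ)).add_const (g 1 1 : ℂ)
  have h0 : HasDerivAt (fun w : ℂ ↦ (g 0 0 : ℂ) * w + g 0 1) (g 0 0) τ := by
    simpa using ((hasDerivAt_id' (τ : ℂ)).const_mul (g 0 0 : ℂ)).add_const (g 0 1 : ℂ)
  have h2 : HasDerivAt (fun w : ℂ ↦ ((g 1 0 : ℂ) * w + g 1 1) ^ (-k))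
      (((-k : ℤ) : ℂ) * ((g 1 0 : ℂ) * τ + g 1 1) ^ (-k - 1) * g 1 0) τ :=
    HasDerivAt.comp (h₂ := fun x : ℂ ↦ x ^ (-k)) (τ : ℂ) (hasDerivAt_zpow (-k) _ (Or.inl hj')) h1
  have h3 := h0.div h1 hj'
  have e := coe_smul_eq g τ
  have h4 : HasDerivAt (fun w : ℂ ↦ φ (ofComplex w) 0)
      (deriv (fun w : ℂ ↦ φ (ofComplex w) 0) (g • τ : ℍ))
      (((g 0 0 : ℂ) * τ + g 0 1) / ((g 1 0 : ℂ) * τ + g 1 1)) := by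
    have := (hφ.differentiableAt_ofComplex 0 (g • τ).im_pos).hasDerivAt
    rwa [e] at this ⊢
  have h5 := h2.mul (h4.comp (τ : ℂ) h3)
  refine h5.congr_deriv ?_
  have e2 : ofComplex (((g 0 0 : ℂ) * τ + g 0 1) / ((g 1 0 : ℂ) * τ + g 1 1)) = g • τ := by
    rw [← ofComplex_apply (g • τ), e]
    rfl
  have hd : (g 0 0 : ℂ) * ((g 1 0 : ℂ) * τ + g 1 1) - ((g 0 0 : ℂ) * τ + g 0 1) * g 1 0 = 1 := by
    linear_combination det_eq_one g
  simp only [Function.comp_apply, Pi.div_apply, e2, hd]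
  rw [← show autFactor g τ = (g 1 0 : ℂ) * τ + g 1 1 from rfl]
  push_cast
  ring

/-- The coefficient `2m` is what makes `D₂` covariant: differentiating the exponential twice yields
`-2mk c/(cτ+d)` times `φ`, and `-2m ∂/∂τ` applied to `(cτ+d)^{-k}` yields the opposite term. -/
lemma D₂_jacobiSlash (k m : ℕ) (g : SL(2, ℤ)) (hφ : IsJointlyHolomorphic φ) :
    D₂ k m (jacobiSlash k m g φ) = (D₂ k m φ) ∣[(k + 2 : ℤ)] g := by
  ext τ
  have hj := autFactor_ne_zero g τ
  have h1 : (fun z : ℂ ↦ jacobiSlash k m g φ τ z) = fun z ↦ autFactor g τ ^ (-k : ℤ) *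
      (cexp (-(2 * π * I * m * g 1 0 / autFactor g τ) * z ^ 2) *
        (fun z ↦ φ (g • τ) (z / autFactor g τ)) z) := by
    ext z
    simp only [jacobiSlash]
    ring_nf
  have hF : Differentiable ℂ fun z ↦ φ (g • τ) (z / autFactor g τ) :=
    (hφ.differentiable (g • τ)).comp (by fun_prop)
  rw [slash_apply_autFactor, D₂, heatOperator, h1, iteratedDeriv_const_mul_field,
    iteratedDeriv_two_cexp_mul hF, iteratedDeriv_two_comp_div (hφ.differentiable _),
    (hasDerivAt_jacobiSlash_zero k m g hφ τ).deriv, D₂, heatOperator, zero_div,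
    zpow_sub_one₀ hj, neg_add, zpow_add₀ hj (-(k : ℤ)) (-2)]
  have hpi : (2 * π * I : ℂ) ≠ 0 := two_pi_I_ne_zero
  rw [show (-2 : ℤ) = -((2 : ℕ) : ℤ) from rfl, zpow_neg _ ((2 : ℕ) : ℤ), zpow_natCast]
  push_cast
  field_simp
  ring

end Holomorphic

/-! ### Fourier expansion and cuspidality of `D₂ φ` -/

lemma nonneg_of_coeff_ne_zero {m M : ℕ} {c : ℤ → ℤ → ℂ} (hm : m ≠ 0)
    (hc : ∀ n r : ℤ, 4 * m * n < M * r ^ 2 → c n r = 0) {n r : ℤ} (h : c n r ≠ 0) : 0 ≤ n := by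
  have h1 : (M : ℤ) * r ^ 2 ≤ 4 * m * n := not_lt.1 fun h' ↦ h (hc n r h')
  have h2 : 0 ≤ (M : ℤ) * r ^ 2 := by positivity
  have h3 : (0 : ℤ) < 4 * m := by positivity
  nlinarith

/-- A term with `n = 0` must have `r = 0`, and both derivatives kill it. Hence every remaining
frequency is at least `2π/M`, which is the reason `D₂` produces cusp forms. -/
lemma HasJacobiExpansion.hasSum_D₂ {k m M : ℕ} (hm : m ≠ 0) (hM : M ≠ 0) {F : ℍ → ℂ → ℂ}
    (hF : HasJacobiExpansion m M F) :
    ∃ d : ℤ × ℤ → ℂ, (∀ p, d p ≠ 0 → 2 * π / M ≤ 2 * π * p.1 / M) ∧ ∀ τ : ℍ,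
      HasSum (fun p ↦ d p * cexp (I * (2 * π * p.1 / M : ℝ) * τ)) (D₂ k m F τ) := by
  obtain ⟨c, hc, hs⟩ := hF
  have hM' : 0 < (M : ℝ) := by positivity
  have hn (p : ℤ × ℤ) (hp : c p.1 p.2 ≠ 0) : 0 ≤ p.1 := nonneg_of_coeff_ne_zero hm hc hp
  refine ⟨fun p ↦ k / (2 * π * I) * -(c p.1 p.2 * (2 * π * p.2 : ℝ) ^ 2) -
    2 * m * (c p.1 p.2 * (I * (2 * π * p.1 / M : ℝ))), fun p hp ↦ ?_, fun τ ↦ ?_⟩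
  · have h0 : c p.1 p.2 ≠ 0 := by
      intro h
      simp [h] at hp
    have h1 : p.1 ≠ 0 := by
      intro h
      have h2 : p.2 = 0 := by
        by_contra h2
        refine h0 (hc _ _ ?_)
        rw [h, mul_zero]
        have : 0 < p.2 ^ 2 := sq_pos_iff.2 h2
        positivity
      simp [h, h2] at hp
    have h2 : (1 : ℝ) ≤ p.1 := by
      have := hn p h0
      exact_mod_cast (show 1 ≤ p.1 by omega)
    refine div_le_div_of_nonneg_right ?_ hM'.le
    nlinarith [Real.pi_pos]
  · have hz (z : ℂ) : HasSum (fun p : ℤ × ℤ ↦ (c p.1 p.2 * cexp (I * (2 * π * p.1 / M : ℝ) * τ)) *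
        cexp (I * (2 * π * p.2 : ℝ) * z)) (F τ z) := by
      refine (hs τ z).congr_fun fun p ↦ ?_
      rw [mul_assoc, ← Complex.exp_add]
      push_cast
      ring_nf
    have hw (w : ℂ) (hw : 0 < w.im) : HasSum (fun p : ℤ × ℤ ↦ c p.1 p.2 *
        cexp (I * (2 * π * p.1 / M : ℝ) * w)) (F (ofComplex w) 0) := by
      rw [ofComplex_apply_of_im_pos hw]
      refine (hs ⟨w, hw⟩ 0).congr_fun fun p ↦ ?_
      push_cast
      ring_nf
    have h1 := hasSum_iteratedDeriv_two_tsum_cexp fun z ↦ (hz z).summable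
    simp only [fun z ↦ (hz z).tsum_eq] at h1
    have h2 := hasSum_deriv_tsum_cexp (c := fun p : ℤ × ℤ ↦ c p.1 p.2)
      (y := fun p ↦ 2 * π * p.1 / M)
      (fun p hp ↦ by
        have : (0 : ℝ) ≤ p.1 := mod_cast hn p hp
        positivity) (fun w h ↦ (hw w h).summable) τ.im_pos
    have hev : (fun w ↦ ∑' p : ℤ × ℤ, c p.1 p.2 * cexp (I * (2 * π * p.1 / M : ℝ) * w)) =ᶠ[𝓝 (τ : ℂ)]
        fun w ↦ F (ofComplex w) 0 := by
      filter_upwards [(isOpen_lt continuous_const Complex.continuous_im).mem_nhds τ.im_pos] with w h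
        using (hw w h).tsum_eq
    rw [hev.deriv_eq] at h2
    refine ((h1.mul_left (k / (2 * π * I))).sub (h2.mul_left (2 * m : ℂ))).congr_fun fun p ↦ ?_
    ring

lemma HasJacobiExpansion.mdifferentiable_D₂ {k m M : ℕ} (hm : m ≠ 0) (hM : M ≠ 0) {F : ℍ → ℂ → ℂ}
    (hF : HasJacobiExpansion m M F) : MDiff (D₂ k m F) := by
  obtain ⟨d, hd, hs⟩ := hF.hasSum_D₂ (k := k) hm hM
  have hM' : 0 < (M : ℝ) := by positivity
  have h := differentiableOn_tsum_cexp (c := d) (y := fun p ↦ 2 * π * p.1 / M)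
    (fun p hp ↦ (by positivity : 0 ≤ 2 * π / M).trans (hd p hp))
    (fun w hw ↦ (hs ⟨w, hw⟩).summable)
  have := mdifferentiable_of_differentiableOn h
  convert! this using 1
  ext τ
  exact (hs τ).tsum_eq.symm

lemma HasJacobiExpansion.isZeroAtImInfty_D₂ {k m M : ℕ} (hm : m ≠ 0) (hM : M ≠ 0)
    {F : ℍ → ℂ → ℂ} (hF : HasJacobiExpansion m M F) : IsZeroAtImInfty (D₂ k m F) := by
  obtain ⟨d, hd, hs⟩ := hF.hasSum_D₂ (k := k) hm hM
  have hM' : 0 < (M : ℝ) := by positivity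
  have h := tendsto_atImInfty_of_hasSum_cexp (δ := 2 * π / M) (by positivity) ∅ hs (by simp)
    (fun p _ hp ↦ hd p hp)
  rwa [Finset.sum_empty] at h

lemma jacobiSlash_one (k : ℤ) (m : ℕ) (φ : ℍ → ℂ → ℂ) : jacobiSlash k m 1 φ = φ := by
  ext τ z
  simp [jacobiSlash, autFactor]

lemma jacobiSlash_eq_smul {k : ℤ} {m M : ℕ} {χ : DirichletCharacter ℂ M} {φ : ℍ → ℂ → ℂ}
    {γ : Gamma0 M} (hφ : ∀ (τ : ℍ) (z : ℂ), φ (γ.1 • τ) (z / autFactor γ.1 τ) =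
      nebentypus χ γ * autFactor γ.1 τ ^ k *
        cexp (2 * π * I * m * ((γ.1 1 0 : ℂ) * z ^ 2 / autFactor γ.1 τ)) * φ τ z) :
    jacobiSlash k m γ.1 φ = nebentypus χ γ • φ := by
  ext τ z
  have hj := autFactor_ne_zero γ.1 τ
  rw [jacobiSlash, hφ τ z]
  simp only [Pi.smul_apply, smul_eq_mul]
  have e : autFactor γ.1 τ ^ (-k) * autFactor γ.1 τ ^ k = 1 := by
    rw [← zpow_add₀ hj, neg_add_cancel, zpow_zero]
  rw [Complex.exp_neg]
  have he := Complex.exp_ne_zero (2 * π * I * m * ((γ.1 1 0 : ℂ) * z ^ 2 / autFactor γ.1 τ))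
  field_simp
  linear_combination nebentypus χ γ * φ τ z * e

theorem D₂_mem_cuspForms {k m M : ℕ} (hm : m ≠ 0) (hM : M ≠ 0) {χ : DirichletCharacter ℂ M}
    {φ : ℍ → ℂ → ℂ} (hφ : φ ∈ jacobiForms k m M χ) :
    D₂ k m φ ∈ cuspForms (k + 2) M (nebentypus χ) := by
  have hol : IsJointlyHolomorphic φ := hφ.1
  have hzero (g : SL(2, ℤ)) : IsZeroAtImInfty ((D₂ k m φ) ∣[(k + 2 : ℤ)] g) := by
    rw [← D₂_jacobiSlash k m g hol]
    exact (hφ.2.2.2 g).isZeroAtImInfty_D₂ hm hM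
  refine ⟨⟨?_, fun γ τ ↦ ?_, fun g ↦ (hzero g).isBoundedAtImInfty⟩, hzero⟩
  · have := (hφ.2.2.2 1).mdifferentiable_D₂ (k := k) hm hM
    rwa [jacobiSlash_one] at this
  · have hj := autFactor_ne_zero γ.1 τ
    have h := congrFun (D₂_jacobiSlash k m γ.1 hol) τ
    rw [jacobiSlash_eq_smul (hφ.2.1 γ), D₂, heatOperator_smul, ← D₂, slash_apply_autFactor, zpow_neg,
      Pi.smul_apply, smul_eq_mul] at h
    have hjk := zpow_ne_zero (k + 2 : ℤ) hj
    field_simp at h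
    linear_combination -h

/-! ### Scaling by `m` -/

/-- The factorization `diag(m, 1) * g = g' * (a, b; 0, d)` with `a d = m`. -/
structure IsScaleFactorization (m : ℕ) (g g' : SL(2, ℤ)) (a d : ℕ) (b : ℤ) : Prop where
  mul_eq : a * d = m
  left_pos : 0 < a
  right_pos : 0 < d
  e00 : (m : ℤ) * g 0 0 = g' 0 0 * a
  e01 : (m : ℤ) * g 0 1 = g' 0 0 * b + g' 0 1 * d
  e10 : g 1 0 = g' 1 0 * a
  e11 : g 1 1 = g' 1 0 * b + g' 1 1 * d

lemma exists_isScaleFactorization {m : ℕ} (hm : m ≠ 0) (g : SL(2, ℤ)) :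
    ∃ (g' : SL(2, ℤ)) (a d : ℕ) (b : ℤ), IsScaleFactorization m g g' a d b := by
  have hdet := g.det_coe
  rw [Matrix.det_fin_two] at hdet
  set α := g 0 0
  set β := g 0 1
  set γ := g 1 0
  set δ := g 1 1
  have hmZ : (0 : ℤ) < m := by positivity
  have hpos : 0 < Int.gcd (m * α) γ := by
    refine Int.gcd_pos_iff.2 ?_
    by_contra! h
    have hα : α = 0 := by simpa [hm] using h.1
    rw [hα, h.2] at hdet
    simp at hdet
  -- The first column of `diag(m,1) g` is `(mα, γ) = a (p, q)` with `p`, `q` coprime. Bézout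
  -- completes `(p, q)` to `g'`, and the determinant forces `d = m/a`.
  set a := Int.gcd (m * α) γ with ha
  obtain ⟨p, hp⟩ : (a : ℤ) ∣ m * α := Int.gcd_dvd_left ..
  obtain ⟨q, hq⟩ : (a : ℤ) ∣ γ := Int.gcd_dvd_right ..
  have haZ : (0 : ℤ) < a := mod_cast hpos
  obtain ⟨u, v, huv⟩ : ∃ u v : ℤ, u * p + v * q = 1 := by
    have h := Int.gcd_eq_gcd_ab (m * α) γ
    rw [← ha] at h
    refine ⟨Int.gcdA (m * α) γ, Int.gcdB (m * α) γ, ?_⟩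
    apply mul_left_cancel₀ haZ.ne'
    linear_combination -h - Int.gcdA (m * α) γ * hp - Int.gcdB (m * α) γ * hq
  have had : (a : ℤ) * (p * δ - q * (m * β)) = m := by
    linear_combination m * hdet - δ * hp + m * β * hq
  have hdpos : 0 < p * δ - q * (m * β) := by
    by_contra! h
    nlinarith
  obtain ⟨d, hd⟩ := Int.eq_ofNat_of_zero_le hdpos.le
  refine ⟨⟨!![p, -v; q, u], by rw [Matrix.det_fin_two_of]; linear_combination huv⟩, a, d,
    u * (m * β) + v * δ, ?_, hpos, ?_, ?_, ?_, ?_, ?_⟩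
  · rw [hd] at had
    exact_mod_cast had
  · rw [hd] at hdpos
    exact_mod_cast hdpos
  · change m * α = p * a
    linear_combination hp
  · change m * β = p * (u * (m * β) + v * δ) + -v * d
    linear_combination -v * hd - m * β * huv
  · change γ = q * a
    linear_combination hq
  · change δ = q * (u * (m * β) + v * δ) + u * d
    linear_combination u * hd - δ * huv

/-- The point `(a τ + b) / d` of the upper half-plane. -/
def affinePoint {a d : ℕ} (ha : 0 < a) (hd : 0 < d) (b : ℤ) (τ : ℍ) : ℍ := ⟨(a * τ + b) / d, by
  have h : ((a * τ + b) / d : ℂ).im = a * τ.im / d := by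
    rw [← ofReal_natCast d, div_ofReal_im, ← ofReal_natCast a, add_im, im_ofReal_mul, intCast_im,
      add_zero, coe_im]
  rw [h]
  have := τ.im_pos
  positivity⟩

lemma coe_affinePoint {a d : ℕ} (ha : 0 < a) (hd : 0 < d) (b : ℤ) (τ : ℍ) :
    (affinePoint ha hd b τ : ℂ) = (a * τ + b) / d := rfl

lemma im_affinePoint {a d : ℕ} (ha : 0 < a) (hd : 0 < d) (b : ℤ) (τ : ℍ) :
    (affinePoint ha hd b τ).im = a * τ.im / d := by
  rw [← coe_im, coe_affinePoint, ← ofReal_natCast d, div_ofReal_im, ← ofReal_natCast a, add_im,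
    im_ofReal_mul, intCast_im, add_zero, coe_im]

section

variable {m a d : ℕ} {b : ℤ} {g g' : SL(2, ℤ)}

lemma IsScaleFactorization.autFactor_eq (h : IsScaleFactorization m g g' a d b) (τ : ℍ) :
    autFactor g τ = autFactor g' (affinePoint h.left_pos h.right_pos b τ) * d := by
  have hd : (d : ℂ) ≠ 0 := by exact_mod_cast h.right_pos.ne'
  simp only [autFactor, coe_affinePoint, h.e10, h.e11]
  push_cast
  field_simp
  ring

lemma IsScaleFactorization.coe_smul_affinePoint (h : IsScaleFactorization m g g' a d b) (τ : ℍ) :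
    ((g' • affinePoint h.left_pos h.right_pos b τ : ℍ) : ℂ) = m * (g • τ : ℍ) := by
  have hd : (d : ℂ) ≠ 0 := by exact_mod_cast h.right_pos.ne'
  have hj := autFactor_ne_zero g' (affinePoint h.left_pos h.right_pos b τ)
  have e00 : (m : ℂ) * g 0 0 = g' 0 0 * a := by exact_mod_cast h.e00
  have e01 : (m : ℂ) * g 0 1 = g' 0 0 * b + g' 0 1 * d := by exact_mod_cast h.e01
  rw [coe_smul_eq, coe_smul_eq, h.autFactor_eq, coe_affinePoint]
  field_simp
  linear_combination (-τ : ℂ) * e00 - e01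

/-- Since `diag(m,1) g = g' (a, b; 0, d)`, this is the index 1 law of `g'` at the point `((aτ+b)/d,
az)`. It covers every `g`, hence every cusp. -/
lemma IsScaleFactorization.thetaWedge_smul (h : IsScaleFactorization m g g' a d b)
    {U : Matrix (Fin (2 * 1)) (Fin (2 * 1)) ℂ} (hU : IsThetaMultiplier 1 g' U) (τ : ℍ) (z : ℂ) :
    thetaWedge (m * (g • τ : ℍ)) (m * (z / autFactor g τ)) =
      U.det / d * autFactor g τ * cexp (2 * π * I * m * ((g 1 0 : ℂ) * z ^ 2 / autFactor g τ)) *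
        thetaWedge (affinePoint h.left_pos h.right_pos b τ) (a * z) := by
  have hd : (d : ℂ) ≠ 0 := by exact_mod_cast h.right_pos.ne'
  have hj := autFactor_ne_zero g' (affinePoint h.left_pos h.right_pos b τ)
  have hm : (a : ℂ) * d = m := by exact_mod_cast h.mul_eq
  have e10 : (g 1 0 : ℂ) = g' 1 0 * a := by exact_mod_cast h.e10
  have e1 : (m * (z / autFactor g τ) : ℂ) =
      a * z / autFactor g' (affinePoint h.left_pos h.right_pos b τ) := by
    rw [h.autFactor_eq, ← hm]
    field_simp
  have e2 : 2 * π * I * m * ((g 1 0 : ℂ) * z ^ 2 / autFactor g τ) = 2 * π * I * ((g' 1 0 : ℂ) *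
      (a * z) ^ 2 / autFactor g' (affinePoint h.left_pos h.right_pos b τ)) := by
    rw [h.autFactor_eq, ← hm, e10]
    field_simp
  rw [e1, e2, ← h.coe_smul_affinePoint, JacobiRestriction.thetaWedge_smul hU, h.autFactor_eq]
  field_simp

lemma isScaleFactorization_conjLevel {m : ℕ} (hm : m ≠ 0) (γ : Gamma0 m) :
    IsScaleFactorization m γ.1 (conjLevel m γ) m 1 0 := by
  have hdvd : (m : ℤ) ∣ γ.1 1 0 := (ZMod.intCast_zmod_eq_zero_iff_dvd _ m).1 (Gamma0_mem.1 γ.2)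
  refine ⟨mul_one m, Nat.pos_of_ne_zero hm, one_pos, ?_, ?_, ?_, ?_⟩
  · change (m : ℤ) * γ.1 0 0 = γ.1 0 0 * m
    ring
  · change (m : ℤ) * γ.1 0 1 = γ.1 0 0 * 0 + γ.1 0 1 * m * (1 : ℕ)
    push_cast
    ring
  · change γ.1 1 0 = γ.1 1 0 / m * m
    rw [Int.ediv_mul_cancel hdvd]
  · change γ.1 1 1 = γ.1 1 0 / m * 0 + γ.1 1 1 * (1 : ℕ)
    push_cast
    ring

end

/-! ### The multiplier `ω_m` -/

lemma isThetaMultiplier_thetaMultiplier (γ : SL(2, ℤ)) :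
    IsThetaMultiplier 1 γ (thetaMultiplier 1 γ) :=
  Classical.epsilon_spec ((exists_isThetaMultiplier γ).imp fun _ h ↦ h.1)

/-- The determinant is read off from the law of the nowhere vanishing `ξ*_1`, so linear independence
of the theta functions is not needed. -/
lemma det_eq_of_isThetaMultiplier {γ : SL(2, ℤ)} {U V : Matrix (Fin (2 * 1)) (Fin (2 * 1)) ℂ}
    (hU : IsThetaMultiplier 1 γ U) (hV : IsThetaMultiplier 1 γ V) : U.det = V.det := by
  have h := (xiStar_one_smul hU UpperHalfPlane.I).symm.trans (xiStar_one_smul hV UpperHalfPlane.I)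
  have h1 := pow_ne_zero 3 (autFactor_ne_zero γ UpperHalfPlane.I)
  exact mul_right_cancel₀ h1 (mul_right_cancel₀ (xiStar_ne_zero one_ne_zero _) h)

lemma norm_det_thetaMultiplier (γ : SL(2, ℤ)) : ‖(thetaMultiplier 1 γ).det‖ = 1 := by
  obtain ⟨U, hU, h⟩ := exists_isThetaMultiplier γ
  rw [← h, det_eq_of_isThetaMultiplier hU (isThetaMultiplier_thetaMultiplier γ)]

lemma omega_mul_conj (m : ℕ) (γ : Gamma0 m) : omega m γ * starRingEnd ℂ (omega m γ) = 1 := by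
  rw [Complex.mul_conj, Complex.normSq_eq_norm_sq, omega, norm_det_thetaMultiplier]
  simp

lemma thetaWedge_Gamma0_smul {m : ℕ} (hm : m ≠ 0) (γ : Gamma0 m) (τ : ℍ) (z : ℂ) :
    thetaWedge (m * (γ.1 • τ : ℍ)) (m * (z / autFactor γ.1 τ)) =
      omega m γ * autFactor γ.1 τ *
        cexp (2 * π * I * m * ((γ.1 1 0 : ℂ) * z ^ 2 / autFactor γ.1 τ)) *
          thetaWedge (m * τ) (m * z) := by
  have h := (isScaleFactorization_conjLevel hm γ).thetaWedge_smul
    (isThetaMultiplier_thetaMultiplier _) τ z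
  rw [h, coe_affinePoint, omega]
  simp

/-! ### Jacobi forms with two theta components -/

/-- The function `f (θ_{m,m} θ^J_{m,0} - θ_{m,0} θ^J_{m,m})`. -/
def starForm (m : ℕ) (f : ℍ → ℂ) (τ : ℍ) (z : ℂ) : ℂ := f τ * thetaWedge (m * τ) (m * z)

lemma starForm_zero (m : ℕ) (f : ℍ → ℂ) (τ : ℍ) : starForm m f τ 0 = 0 := by
  rw [starForm, mul_zero, thetaWedge_zero, mul_zero]

lemma starForm_injective {m : ℕ} (hm : m ≠ 0) : Function.Injective (starForm m) := by
  intro f f' h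
  ext τ
  obtain ⟨z, hz⟩ := exists_thetaWedge_ne_zero (scale m hm τ)
  have h1 := congrFun (congrFun h τ) (z / m)
  have hm' : (m : ℂ) ≠ 0 := mod_cast hm
  simp only [starForm, mul_div_cancel₀ z hm', ← coe_scale m hm] at h1
  exact mul_right_cancel₀ hz h1

/-- The constant is `k/(2πi) · m² · 8πi = 4km²`, with `m²` from the chain rule in `mz`. One factor
`m` is absorbed by `ξ*_m(τ) = m ξ*_1(mτ)`. -/
lemma D₂_starForm (k : ℕ) {m : ℕ} (hm : m ≠ 0) (f : ℍ → ℂ) (τ : ℍ) :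
    D₂ k m (starForm m f) τ = 4 * m * k * xiStar m τ * f τ := by
  have hm' : (m : ℂ) ≠ 0 := mod_cast hm
  have h1 : starForm m f τ = fun z ↦ f τ * thetaWedge (scale m hm τ) (z / (m : ℂ)⁻¹) := by
    ext z
    rw [starForm, coe_scale, div_inv_eq_mul, mul_comm z]
  rw [D₂, heatOperator_of_apply_zero _ _ (starForm_zero m f), h1, iteratedDeriv_const_mul_field,
    iteratedDeriv_two_comp_div (differentiable_thetaWedge (scale m hm τ).im_pos),
    iteratedDeriv_two_thetaWedge, xiStar_eq_mul_xiStar_one hm]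
  have hpi : (π : ℂ) ≠ 0 := mod_cast Real.pi_ne_zero
  field_simp
  ring

lemma IsScaleFactorization.jacobiSlash_starForm {m a d : ℕ} {b : ℤ} {g g' : SL(2, ℤ)}
    (h : IsScaleFactorization m g g' a d b) (k : ℤ) (f : ℍ → ℂ) (τ : ℍ) (z : ℂ) :
    jacobiSlash k m g (starForm m f) τ z = (thetaMultiplier 1 g').det / d * (f ∣[(k - 1)] g) τ *
      thetaWedge (affinePoint h.left_pos h.right_pos b τ) (a * z) := by
  have hj := autFactor_ne_zero g τ
  rw [jacobiSlash, starForm, h.thetaWedge_smul (isThetaMultiplier_thetaMultiplier _),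
    slash_apply_autFactor, show -(k - 1) = -k + 1 by ring, zpow_add_one₀ hj, Complex.exp_neg]
  have he := Complex.exp_ne_zero (2 * π * I * m * ((g 1 0 : ℂ) * z ^ 2 / autFactor g τ))
  field_simp

lemma isThetaDecomposition_starForm {m : ℕ} (hm : m ≠ 0) (f : ℍ → ℂ) :
    IsThetaDecomposition m (starForm m f) fun r τ ↦
      if r = 0 then f τ * theta m m τ else if r = m then -(f τ * theta m 0 τ) else 0 := by
  intro τ z
  rw [Finset.sum_eq_add_of_mem 0 m (Finset.mem_range.2 (by omega)) (Finset.mem_range.2 (by omega))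
    hm.symm (fun r _ hr ↦ by simp [hr.1, hr.2])]
  simp only [if_true, if_neg hm, starForm, thetaWedge_mul m hm]
  ring

/-- The `z`-frequencies of `θ^J_{m,r}` are the integers `2mn + r`. Among residues in `[0, 2m)` the
mode `j` occurs only for `r = j`, `n = 0`, so modes separate the components. -/
lemma fourierMode_thetaJ {m : ℕ} (hm : m ≠ 0) {τ : ℂ} (hτ : 0 < τ.im) {r j : ℕ} (hr : r < 2 * m)
    (hj : j < 2 * m) : fourierMode j (thetaJ m r τ) =
      if r = j then cexp (2 * π * I * (j ^ 2 * τ / (4 * m))) else 0 := by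
  have h := hasSum_fourierMode_thetaJ hm r hτ 1 j
  simp only [Nat.cast_one, one_mul, mul_one] at h
  refine (h.unique (hasSum_single (0 : ℤ) fun n hn ↦ if_neg fun h ↦ hn ?_)).trans ?_
  · have h1 : (2 * m : ℤ) * n < 2 * m * 1 := by omega
    have h2 : (2 * m : ℤ) * (-1) < 2 * m * n := by omega
    have hm0 : (0 : ℤ) ≤ 2 * m := by positivity
    have h3 := lt_of_mul_lt_mul_left h1 hm0
    have h4 := lt_of_mul_lt_mul_left h2 hm0
    omega
  · simp only [mul_zero, zero_add, Int.cast_zero, Nat.cast_inj]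
    split_ifs with h
    · rw [h]
    · rfl

lemma fourierMode_finset_sum {ι : Type*} (s : Finset ι) (F : ι → ℂ → ℂ)
    (hF : ∀ i ∈ s, Continuous (F i)) (a : ℤ) :
    fourierMode a (fun z ↦ ∑ i ∈ s, F i z) = ∑ i ∈ s, fourierMode a (F i) := by
  simp only [fourierMode, Finset.sum_mul]
  refine intervalIntegral.integral_finsetSum fun i hi ↦ Continuous.intervalIntegrable ?_ _ _
  have := hF i hi
  fun_prop

lemma continuous_thetaJ {m : ℕ} (hm : m ≠ 0) (r : ℕ) {τ : ℂ} (hτ : 0 < τ.im) :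
    Continuous (thetaJ m r τ) :=
  Differentiable.continuous (𝕜 := ℂ) fun z ↦ differentiableAt_thetaJ_snd hm r hτ z

lemma IsThetaDecomposition.fourierMode_eq {m : ℕ} (hm : m ≠ 0) {φ : ℍ → ℂ → ℂ} {h : ℕ → ℍ → ℂ}
    (hd : IsThetaDecomposition m φ h) {j : ℕ} (hj : j < 2 * m) (τ : ℍ) :
    fourierMode j (φ τ) = h j τ * cexp (2 * π * I * (j ^ 2 * τ / (4 * m))) := by
  rw [show φ τ = _ from funext (hd τ), fourierMode_finset_sum _ _ fun r _ ↦
    (continuous_thetaJ hm r τ.im_pos).const_mul _]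
  simp only [fourierMode_const_mul]
  rw [Finset.sum_eq_single_of_mem j (Finset.mem_range.2 hj)]
  · rw [fourierMode_thetaJ hm τ.im_pos hj hj, if_pos rfl]
  · intro r hr hne
    rw [fourierMode_thetaJ hm τ.im_pos (Finset.mem_range.1 hr) hj, if_neg hne, mul_zero]

/-- The theta components are unique. -/
lemma IsThetaDecomposition.eq {m : ℕ} (hm : m ≠ 0) {φ : ℍ → ℂ → ℂ} {h h' : ℕ → ℍ → ℂ}
    (hd : IsThetaDecomposition m φ h) (hd' : IsThetaDecomposition m φ h') {j : ℕ}
    (hj : j < 2 * m) : h j = h' j := by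
  ext τ
  exact mul_right_cancel₀ (Complex.exp_ne_zero _)
    ((hd.fourierMode_eq hm hj τ).symm.trans (hd'.fourierMode_eq hm hj τ))

lemma exists_eq_starForm {k : ℤ} {m N : ℕ} (hm : m ≠ 0) {χ : DirichletCharacter ℂ (m * N)}
    {φ : ℍ → ℂ → ℂ} (hφ : φ ∈ jacobiStarKernel k m N χ) : ∃ f, φ = starForm m f := by
  obtain ⟨-, ⟨h, hd, hv⟩, h0⟩ := hφ
  have hφ' (τ : ℍ) (z : ℂ) : φ τ z = h 0 τ * thetaJ m 0 τ z + h m τ * thetaJ m m τ z := by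
    rw [hd τ z, Finset.sum_eq_add_of_mem 0 m (Finset.mem_range.2 (by omega))
      (Finset.mem_range.2 (by omega)) hm.symm]
    intro r hr hne
    rw [hv r (Finset.mem_range.1 hr) hne.1 hne.2]
    simp
  refine ⟨fun τ ↦ h 0 τ / theta m m τ, funext₂ fun τ z ↦ ?_⟩
  have h1 := theta_self_ne_zero hm τ
  have h2 : h 0 τ * theta m 0 τ + h m τ * theta m m τ = 0 := by
    rw [← h0 τ, hφ' τ 0]
    rfl
  rw [starForm, thetaWedge_mul m hm, hφ']
  field_simp
  linear_combination thetaJ m m τ z * h2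

/-! ### From the Jacobi form back to the modular form -/

section

variable {m N : ℕ} {χ : DirichletCharacter ℂ (m * N)} {f : ℍ → ℂ}

/-- The transformation law of `starForm m f` under `Γ₀(mN)` in terms of that of `f`. -/
lemma starForm_transform_iff (hm : m ≠ 0) (k : ℤ) (γ : Gamma0 (m * N)) (τ : ℍ) :
    (∀ z, starForm m f (γ.1 • τ) (z / autFactor γ.1 τ) = nebentypus χ γ * autFactor γ.1 τ ^ k *
      cexp (2 * π * I * m * ((γ.1 1 0 : ℂ) * z ^ 2 / autFactor γ.1 τ)) * starForm m f τ z) ↔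
    f (γ.1 • τ) = twistedNebentypus m χ γ * autFactor γ.1 τ ^ (k - 1) * f τ := by
  have hj := autFactor_ne_zero γ.1 τ
  have hw (z : ℂ) := thetaWedge_Gamma0_smul hm ⟨γ.1, Gamma0_mul_le m N γ.2⟩ τ z
  have hω := omega_mul_conj m ⟨γ.1, Gamma0_mul_le m N γ.2⟩
  simp only [starForm, twistedNebentypus, hw]
  set ω := omega m ⟨γ.1, Gamma0_mul_le m N γ.2⟩
  set ω' := starRingEnd ℂ ω
  have hz := zpow_add_one₀ hj (k - 1)
  rw [sub_add_cancel] at hz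
  rw [hz]
  constructor
  · intro h
    obtain ⟨z, hz⟩ := exists_thetaWedge_ne_zero (scale m hm τ)
    have h1 := h (z / m)
    have hm' : (m : ℂ) ≠ 0 := mod_cast hm
    rw [mul_div_cancel₀ z hm', ← coe_scale m hm] at h1
    have he := Complex.exp_ne_zero (2 * π * I * m * ((γ.1 1 0 : ℂ) * (z / m) ^ 2 / autFactor γ.1 τ))
    have h2 : f (γ.1 • τ) * ω = nebentypus χ γ * autFactor γ.1 τ ^ (k - 1) * f τ := by
      refine mul_right_cancel₀ (mul_ne_zero (mul_ne_zero hj he) hz) ?_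
      linear_combination h1
    linear_combination ω' * h2 - f (γ.1 • τ) * hω
  · intro h z
    rw [h]
    linear_combination (nebentypus χ γ * autFactor γ.1 τ ^ (k - 1) * f τ * autFactor γ.1 τ *
      cexp (2 * π * I * m * ((γ.1 1 0 : ℂ) * z ^ 2 / autFactor γ.1 τ)) *
        thetaWedge (m * τ) (m * z)) * hω

/-- Holomorphy comes from `f = D₂ φ / (4mk ξ*_m)`, with holomorphic numerator and nowhere vanishing
denominator. -/
lemma mdifferentiable_of_starForm_mem {k : ℕ} (hk : k ≠ 0) (hm : m ≠ 0) (hN : N ≠ 0)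
    (hφ : starForm m f ∈ jacobiForms k m (m * N) χ) : MDiff f := by
  have h := (D₂_mem_cuspForms hm (mul_ne_zero hm hN) hφ).1.1
  have hk' : (k : ℂ) ≠ 0 := mod_cast hk
  have hm' : (m : ℂ) ≠ 0 := mod_cast hm
  have h1 := UpperHalfPlane.mdifferentiable_iff.1 h
  have h2 := UpperHalfPlane.mdifferentiable_iff.1 (mdifferentiable_xiStar hm)
  refine UpperHalfPlane.mdifferentiable_iff.2 ((h1.div (h2.const_mul (4 * m * k : ℂ))
    fun w _ ↦ ?_).congr fun w _ ↦ ?_)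
  · simp [hk', hm', xiStar_ne_zero hm]
  · simp only [Pi.div_apply, Function.comp_apply, D₂_starForm k hm]
    have := xiStar_ne_zero hm (ofComplex w)
    field_simp

lemma fourierMode_sub {F G : ℂ → ℂ} (hF : Continuous F) (hG : Continuous G) (a : ℤ) :
    fourierMode a (fun z ↦ F z - G z) = fourierMode a F - fourierMode a G := by
  simp only [fourierMode, sub_mul]
  exact intervalIntegral.integral_sub (Continuous.intervalIntegrable (by fun_prop) _ _)
    (Continuous.intervalIntegrable (by fun_prop) _ _)

/-- After `z ↦ az` the component `θ^J_{1,0}` has only even multiples of `a` as frequencies, while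
`θ^J_{1,1}` has odd ones, and `a` itself arises only from `n = 0`. -/
lemma fourierMode_thetaWedge {a : ℕ} (ha : 0 < a) (τ : ℍ) :
    fourierMode a (fun z ↦ thetaWedge τ (a * z)) =
      -(theta 1 0 τ * cexp (2 * π * I * (τ / 4))) := by
  have hc (r : ℕ) := continuous_thetaJ one_ne_zero r τ.im_pos
  have haZ : (a : ℤ) ≠ 0 := by positivity
  have h0 : fourierMode a (fun z ↦ thetaJ 1 0 τ (a * z)) = 0 := by
    have h := hasSum_fourierMode_thetaJ one_ne_zero 0 τ.im_pos a a
    refine (h.unique (hasSum_single (0 : ℤ) fun n _ ↦ if_neg fun h ↦ ?_)).trans ?_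
    · have : (2 * (1 : ℕ) * n + (0 : ℕ) : ℤ) = 1 := by
        apply mul_right_cancel₀ haZ
        linear_combination h
      push_cast at this
      omega
    · simp [haZ.symm]
  have h1 : fourierMode a (fun z ↦ thetaJ 1 1 τ (a * z)) = cexp (2 * π * I * (τ / 4)) := by
    have h := hasSum_fourierMode_thetaJ one_ne_zero 1 τ.im_pos a a
    refine (h.unique (hasSum_single (0 : ℤ) fun n hn ↦ if_neg fun h ↦ hn ?_)).trans ?_
    · have : (2 * (1 : ℕ) * n + (1 : ℕ) : ℤ) = 1 := by
        apply mul_right_cancel₀ haZ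
        linear_combination h
      push_cast at this
      omega
    · simp
  simp only [thetaWedge]
  have hc0 : Continuous fun z : ℂ ↦ thetaJ 1 0 τ (a * z) := (hc 0).comp (by fun_prop)
  have hc1 : Continuous fun z : ℂ ↦ thetaJ 1 1 τ (a * z) := (hc 1).comp (by fun_prop)
  rw [fourierMode_sub (hc0.const_mul _) (hc1.const_mul _), fourierMode_const_mul,
    fourierMode_const_mul, h0, h1]
  ring

lemma HasJacobiExpansion.exists_norm_fourierMode_le {M : ℕ} (hm : m ≠ 0) (hM : M ≠ 0)
    {F : ℍ → ℂ → ℂ} (hF : HasJacobiExpansion m M F) (a : ℤ) :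
    ∃ C, ∀ τ : ℍ, 1 ≤ τ.im →
      ‖fourierMode a (F τ)‖ ≤ C * Real.exp (-(2 * π * (a ^ 2 / (4 * m)) * τ.im)) := by
  obtain ⟨c, hc, hs⟩ := hF
  have hm0 : (0 : ℝ) < m := by positivity
  have hM0 : (0 : ℝ) < M := by positivity
  have h (τ : ℍ) : HasSum (fun p : ℤ × ℤ ↦ (if p.2 = a then c p.1 p.2 else 0) *
      cexp (I * (2 * π * p.1 / M : ℝ) * τ)) (fourierMode a (F τ)) := by
    have h1 := hasSum_fourierMode (A := fun p : ℤ × ℤ ↦ c p.1 p.2 *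
      cexp (I * (2 * π * p.1 / M : ℝ) * τ)) (r := fun p ↦ p.2) (F := F τ) (fun t ↦ ?_) a
    · refine h1.congr_fun fun p ↦ ?_
      split_ifs <;> simp
    · refine (hs τ t).congr_fun fun p ↦ ?_
      rw [mul_assoc, ← Complex.exp_add]
      push_cast
      ring_nf
  have hy (p : ℤ × ℤ) (hp : (if p.2 = a then c p.1 p.2 else 0) ≠ 0) :
      2 * π * (a ^ 2 / (4 * m)) ≤ 2 * π * p.1 / M := by
    have hpa : p.2 = a := by
      by_contra h
      simp [h] at hp
    have h1 : (M : ℤ) * a ^ 2 ≤ 4 * m * p.1 := by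
      rw [← hpa]
      refine not_lt.1 fun h' ↦ hp ?_
      simp [hc _ _ h']
    have h2 : (M : ℝ) * a ^ 2 ≤ 4 * m * p.1 := by exact_mod_cast h1
    rw [mul_div_assoc]
    refine mul_le_mul_of_nonneg_left ?_ (by positivity)
    rw [div_le_div_iff₀ (by positivity) hM0]
    linarith
  obtain ⟨C, hC⟩ := exists_norm_le_of_hasSum_cexp hy (h UpperHalfPlane.I).summable
  exact ⟨C, fun τ hτ ↦ hC τ _ hτ (h τ)⟩

/-- Compare the mode `ζ^a` on both sides. The expansion condition bounds it by a multiple of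
`exp(-2π (a²/4m) Im τ)`. The wedge contributes `θ_{1,0}` at `w = (aτ+b)/d` times `e^{2πiw/4}`, whose
absolute value is exactly this exponential because `a/d = a²/m`. As `θ_{1,0} → 1`, the remaining
factor `f ∣[k-1] g` is bounded. -/
lemma isBoundedAtImInfty_slash_of_starForm {k : ℤ} (hm : m ≠ 0) (hN : N ≠ 0) (g : SL(2, ℤ))
    (hexp : HasJacobiExpansion m (m * N) (jacobiSlash k m g (starForm m f))) :
    IsBoundedAtImInfty (f ∣[(k - 1)] g) := by
  obtain ⟨g', a, d, b, h⟩ := exists_isScaleFactorization hm g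
  obtain ⟨C, hC⟩ := hexp.exists_norm_fourierMode_le hm (mul_ne_zero hm hN) a
  have ha : (0 : ℝ) < a := mod_cast h.left_pos
  have hd : (0 : ℝ) < d := mod_cast h.right_pos
  have had : (a : ℝ) * d = m := mod_cast h.mul_eq
  have hmode (τ : ℍ) : ‖fourierMode a (jacobiSlash k m g (starForm m f) τ)‖ =
      1 / d * ‖(f ∣[(k - 1)] g) τ‖ * (‖theta 1 0 (affinePoint h.left_pos h.right_pos b τ)‖ *
        Real.exp (-(2 * π * (a ^ 2 / (4 * m)) * τ.im))) := by
    rw [show jacobiSlash k m g (starForm m f) τ = _ from funext (h.jacobiSlash_starForm k f τ),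
      fourierMode_const_mul, fourierMode_thetaWedge h.left_pos, norm_mul, norm_mul, norm_neg,
      norm_mul, norm_div, norm_det_thetaMultiplier, norm_natCast]
    congr 2
    rw [show 2 * π * I * ((affinePoint h.left_pos h.right_pos b τ : ℂ) / 4) =
      I * (2 * π / 4 : ℝ) * (affinePoint h.left_pos h.right_pos b τ : ℂ) by push_cast; ring,
      norm_cexp_I_mul, coe_im, im_affinePoint, ← had]
    congr 1
    field_simp
  have hlim : Tendsto (fun τ ↦ affinePoint h.left_pos h.right_pos b τ) atImInfty atImInfty := by
    refine tendsto_comap_iff.2 ?_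
    have : Tendsto (fun τ : ℍ ↦ a / d * τ.im) atImInfty atTop :=
      Tendsto.const_mul_atTop (by positivity) tendsto_comap
    refine this.congr fun τ ↦ ?_
    rw [Function.comp_apply, im_affinePoint]
    ring
  have hev : ∀ᶠ τ in atImInfty,
      1 / 2 < ‖theta 1 0 (affinePoint h.left_pos h.right_pos b τ)‖ :=
    ((tendsto_theta_one_zero.comp hlim).norm).eventually_const_lt (by norm_num)
  have hev1 : ∀ᶠ τ : ℍ in atImInfty, 1 ≤ τ.im := tendsto_comap.eventually_ge_atTop 1
  -- The factor `2` compensates `‖θ_{1,0}‖ > 1/2` and the factor `d` compensates `1/d`.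
  refine Asymptotics.IsBigO.of_bound (2 * d * C) ?_
  filter_upwards [hev, hev1] with τ h1 h2
  have h3 := hC τ h2
  rw [hmode, ← mul_assoc] at h3
  have h4 := le_of_mul_le_mul_right h3 (Real.exp_pos _)
  simp only [Pi.one_apply, norm_one, mul_one]
  have h5 : 1 / d * ‖(f ∣[(k - 1)] g) τ‖ * (1 / 2) ≤ C :=
    (mul_le_mul_of_nonneg_left h1.le (by positivity)).trans h4
  rw [div_mul_eq_mul_div, one_mul, div_mul_eq_mul_div, div_le_iff₀ hd] at h5
  linarith

theorem mem_modularForms_of_starForm_mem {k : ℕ} (hk : k ≠ 0) (hm : m ≠ 0) (hN : N ≠ 0)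
    (hφ : starForm m f ∈ jacobiForms k m (m * N) χ) :
    f ∈ modularForms (k - 1) (m * N) (twistedNebentypus m χ) :=
  ⟨mdifferentiable_of_starForm_mem hk hm hN hφ,
    fun γ τ ↦ (starForm_transform_iff hm k γ τ).1 (hφ.2.1 γ τ),
    fun g ↦ isBoundedAtImInfty_slash_of_starForm hm hN g (hφ.2.2.2 g)⟩

end

/-! ### Fourier expansions of Jacobi forms -/

section Expansion

variable {m M : ℕ} {F F' : ℍ → ℂ → ℂ}

/-- Any absolutely convergent double exponential series may be regrouped along the fibres of `(n,
r)`, even if these are infinite, so products of series can be used without computing coefficients.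
-/
lemma hasJacobiExpansion_of_hasSum {ι : Type*} (A : ι → ℂ) (n r : ι → ℤ)
    (hA : ∀ i, A i ≠ 0 → M * r i ^ 2 ≤ 4 * m * n i)
    (hF : ∀ (τ : ℍ) (z : ℂ), HasSum
      (fun i ↦ A i * cexp (2 * π * I * (n i * (τ : ℂ) / M + r i * z))) (F τ z)) :
    HasJacobiExpansion m M F := by
  let s (p : ℤ × ℤ) : Set ι := (fun i ↦ (n i, r i)) ⁻¹' {p}
  refine ⟨fun a b ↦ ∑' i : s (a, b), A i, fun a b hab ↦ ?_, fun τ z ↦ ?_⟩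
  · refine (tsum_congr fun i ↦ ?_).trans tsum_zero
    obtain ⟨h1, h2⟩ : n i = a ∧ r i = b := Prod.mk.inj i.2
    by_contra h
    have h3 := hA i h
    rw [h1, h2] at h3
    exact absurd h3 (not_le.2 hab)
  · refine ((hF τ z).tsum_fiberwise fun i ↦ (n i, r i)).congr_fun fun p ↦ ?_
    rw [← tsum_mul_right]
    refine tsum_congr fun i ↦ ?_
    obtain ⟨h1, h2⟩ : n i = p.1 ∧ r i = p.2 := Prod.mk.inj i.2
    rw [h1, h2]

lemma HasJacobiExpansion.sub (hF : HasJacobiExpansion m M F) (hF' : HasJacobiExpansion m M F') :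
    HasJacobiExpansion m M (F - F') := by
  obtain ⟨c, hc, hs⟩ := hF
  obtain ⟨c', hc', hs'⟩ := hF'
  refine ⟨c - c', fun n r h ↦ by simp [hc n r h, hc' n r h], fun τ z ↦ ?_⟩
  exact ((hs τ z).sub (hs' τ z)).congr_fun fun p ↦ by simp [sub_mul]

lemma HasJacobiExpansion.const_smul (a : ℂ) (hF : HasJacobiExpansion m M F) :
    HasJacobiExpansion m M (a • F) := by
  obtain ⟨c, hc, hs⟩ := hF
  refine ⟨a • c, fun n r h ↦ by simp [hc n r h], fun τ z ↦ ?_⟩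
  exact ((hs τ z).mul_left a).congr_fun fun p ↦ by simp [mul_assoc]

/-- The `q`-expansion of a function with multiplier `exp (-2πi t / 4)` under `τ ↦ τ + M`. -/
lemma exists_hasSum_of_isBoundedAtImInfty (hM : M ≠ 0) {f : ℍ → ℂ} (hf : MDiff f)
    (hb : IsBoundedAtImInfty f) {t : ℕ}
    (hper : ∀ τ, f ((M : ℝ) +ᵥ τ) * cexp (2 * π * I * (t / 4)) = f τ) :
    ∃ (n : ℕ → ℕ) (c : ℕ → ℂ), (∀ j, c j ≠ 0 → t ≤ 4 * n j) ∧ ∀ τ : ℍ,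
      HasSum (fun j ↦ c j * cexp (2 * π * I * (n j * τ / M)))
        (f τ * cexp (2 * π * I * (t * τ / (4 * M)))) := by
  have hMC : (M : ℂ) ≠ 0 := mod_cast hM
  have hM0 : (0 : ℝ) < M := by positivity
  -- Integer quotient and remainder: `e^{2πi rτ/4M}` already makes `f` periodic under `M`, and the
  -- remaining `e^{2πi sτ/M}` shifts all exponents by `s`.
  set s := t / 4
  set r := t % 4
  have ht : (t : ℂ) = 4 * s + r := by exact_mod_cast (Nat.div_add_mod t 4).symm
  let E : ℂ → ℂ := fun w ↦ cexp (I * (2 * π * r / (4 * M) : ℝ) * w)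
  have hE (w : ℂ) : E w = cexp (2 * π * I * (r * w / (4 * M))) := by
    simp only [E]
    push_cast
    ring_nf
  have hEn (τ : ℍ) : ‖E τ‖ = Real.exp (-(2 * π * r / (4 * M) * τ.im)) := norm_cexp_I_mul _ _
  let H : ℍ → ℂ := fun τ ↦ f τ * E τ
  have hHd : MDiff H := hf.mul (mdifferentiable_of_differentiableOn (by fun_prop))
  have hE1 : IsBoundedAtImInfty fun τ : ℍ ↦ E τ := by
    refine Asymptotics.IsBigO.of_bound 1 (.of_forall fun τ ↦ ?_)
    rw [hEn]
    simp only [Pi.one_apply, norm_one, mul_one, Real.exp_le_one_iff, neg_nonpos]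
    have := τ.im_pos
    positivity
  have hHb : IsBoundedAtImInfty H := hb.mul hE1
  have hHp : Function.Periodic (H ∘ ofComplex) ((M : ℝ) : ℂ) := by
    intro w
    by_cases! hw : 0 < w.im
    · have hw' : 0 < (w + (M : ℝ)).im := by simpa using hw
      simp only [Function.comp_apply, ofComplex_apply_of_im_pos hw', ofComplex_apply_of_im_pos hw]
      have e : (⟨w + (M : ℝ), hw'⟩ : ℍ) = (M : ℝ) +ᵥ (⟨w, hw⟩ : ℍ) := by
        ext
        simp [add_comm]
      simp only [H]
      rw [← hper ⟨w, hw⟩, e, mul_assoc, hE, hE, ← Complex.exp_add, ht,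
        ← cexp_add_two_pi_I_intCast _ s]
      congr 2
      push_cast
      field_simp
      ring
    -- Off the upper half-plane `ofComplex` takes a single value, so periodicity is automatic there.
    · have hw' : (w + (M : ℝ)).im ≤ 0 := by simpa using hw
      rw [Function.comp_apply, Function.comp_apply, ofComplex_apply_eq_of_im_nonpos hw' hw]
  refine ⟨fun j ↦ j + s, fun j ↦ (qExpansion M H).coeff j, fun j hj ↦ ?_, fun τ ↦ ?_⟩
  -- If `r = 0` then `t = 4s`. If `r > 0`, the decay of `E` kills the coefficient `j = 0`, and `j ≥
  -- 1` gives `4(j + s) ≥ 4 + 4s > t`.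
  · rcases Nat.eq_zero_or_pos r with hr | hr
    · simp only [r, s] at hr ⊢
      omega
    rcases Nat.eq_zero_or_pos j with rfl | hj0
    · exfalso
      have hH0 : IsZeroAtImInfty H := by
        have hlim : Tendsto (fun τ : ℍ ↦ E τ) atImInfty (𝓝 0) := by
          rw [tendsto_zero_iff_norm_tendsto_zero]
          simp only [hEn]
          exact Real.tendsto_exp_neg_atTop_nhds_zero.comp
            (Tendsto.const_mul_atTop (by positivity) tendsto_comap)
        have hb' : f =O[atImInfty] fun _ ↦ (1 : ℂ) := by
          simpa [IsBoundedAtImInfty, BoundedAtFilter, Pi.one_def, Asymptotics.isBigO_one_iff]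
            using hb
        have h := hb'.mul_isLittleO ((Asymptotics.isLittleO_one_iff ℂ).2 hlim)
        rw [one_mul] at h
        exact (Asymptotics.isLittleO_one_iff ℂ).1 h
      refine hj ?_
      beta_reduce
      rw [qExpansion_coeff, iteratedDeriv_zero, hH0.cuspFunction_apply_zero hM0, mul_zero]
    · simp only [s]
      omega
  · have h := (hasSum_qExpansion hM0 hHp hHd hHb τ).mul_right (cexp (2 * π * I * (s * τ / M)))
    have e : f τ * cexp (2 * π * I * (t * τ / (4 * M))) =
        H τ * cexp (2 * π * I * (s * τ / M)) := by
      simp only [H]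
      rw [mul_assoc (f τ), hE, ← Complex.exp_add, ht]
      congr 2
      field_simp
      ring
    rw [e]
    refine h.congr_fun fun j ↦ ?_
    rw [smul_eq_mul, Function.Periodic.qParam, ← Complex.exp_nat_mul,
      mul_assoc ((qExpansion M H).coeff j), ← Complex.exp_add]
    congr 2
    push_cast
    field_simp

end Expansion

/-! ### The Jacobi slash action and translations -/

section Slash

lemma jacobiSlash_mul (k : ℤ) (m : ℕ) (γ δ : SL(2, ℤ)) (φ : ℍ → ℂ → ℂ) :
    jacobiSlash k m (γ * δ) φ = jacobiSlash k m δ (jacobiSlash k m γ φ) := by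
  ext τ z
  simp only [jacobiSlash]
  rw [jacobi_exponent_mul, autFactor_mul, mul_zpow, mul_add, neg_add, Complex.exp_add, mul_smul,
    mul_comm (autFactor γ (δ • τ)), ← div_div]
  ring

lemma jacobiSlash_T_zpow (k : ℤ) (m : ℕ) (n : ℤ) (φ : ℍ → ℂ → ℂ) (τ : ℍ) (z : ℂ) :
    jacobiSlash k m (ModularGroup.T ^ n) φ τ z = φ ((n : ℝ) +ᵥ τ) z := by
  have h : autFactor (ModularGroup.T ^ n) τ = 1 := by
    simp [autFactor, ModularGroup.coe_T_zpow]
  rw [jacobiSlash, h, modular_T_zpow_smul]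
  simp [ModularGroup.coe_T_zpow]

/-- `T^M` lies in the normal subgroup `Γ(M)`, so its conjugate by `g` lies in `Γ₀(M)` with `d ≡ 1`,
and the character is trivial on it. -/
lemma jacobiSlash_vadd {k : ℤ} {m M : ℕ} {χ : DirichletCharacter ℂ M} {φ : ℍ → ℂ → ℂ}
    (hφ : ∀ (γ : Gamma0 M) (τ : ℍ) (z : ℂ), φ (γ.1 • τ) (z / autFactor γ.1 τ) =
      nebentypus χ γ * autFactor γ.1 τ ^ k *
        cexp (2 * π * I * m * ((γ.1 1 0 : ℂ) * z ^ 2 / autFactor γ.1 τ)) * φ τ z)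
    (g : SL(2, ℤ)) (τ : ℍ) (z : ℂ) :
    jacobiSlash k m g φ ((M : ℝ) +ᵥ τ) z = jacobiSlash k m g φ τ z := by
  have hT : ModularGroup.T ^ (M : ℤ) ∈ CongruenceSubgroup.Gamma M := by
    simpa using ModularGroup_T_pow_mem_Gamma M M dvd_rfl
  have hγ : g * ModularGroup.T ^ (M : ℤ) * g⁻¹ ∈ CongruenceSubgroup.Gamma M :=
    (CongruenceSubgroup.Gamma_normal (N := M)).conj_mem _ hT g
  obtain ⟨-, -, h10, h11⟩ := Gamma_mem.1 hγ
  have h := jacobiSlash_eq_smul (hφ ⟨_, Gamma0_mem.2 h10⟩)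
  rw [nebentypus, h11, map_one, one_smul] at h
  have h1 := jacobiSlash_mul k m (g * ModularGroup.T ^ (M : ℤ) * g⁻¹) g φ
  rw [h, inv_mul_cancel_right, jacobiSlash_mul] at h1
  have h2 := congrFun (congrFun h1 τ) z
  rwa [jacobiSlash_T_zpow, Int.cast_natCast] at h2

end Slash

/-! ### From the modular form to the Jacobi form -/

section

variable {m N a d : ℕ} {b : ℤ} {g g' : SL(2, ℤ)} {χ : DirichletCharacter ℂ (m * N)} {f : ℍ → ℂ}

/-- Translating `τ` by `mN` moves `(aτ+b)/d` by the integer `a²N`, which multiplies the wedge by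
`e^{2πi a²N/4}`. The slashed product is invariant, so `f ∣[k-1] g` acquires the inverse factor. -/
lemma IsScaleFactorization.slash_vadd_mul (h : IsScaleFactorization m g g' a d b) {k : ℤ}
    (hφ : ∀ (γ : Gamma0 (m * N)) (τ : ℍ) (z : ℂ),
      starForm m f (γ.1 • τ) (z / autFactor γ.1 τ) = nebentypus χ γ * autFactor γ.1 τ ^ k *
        cexp (2 * π * I * m * ((γ.1 1 0 : ℂ) * z ^ 2 / autFactor γ.1 τ)) * starForm m f τ z)
    (τ : ℍ) : (f ∣[(k - 1)] g) (((m * N : ℕ) : ℝ) +ᵥ τ) *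
      cexp (2 * π * I * ((a ^ 2 * N : ℕ) / 4)) = (f ∣[(k - 1)] g) τ := by
  have ha : (a : ℂ) ≠ 0 := by exact_mod_cast h.left_pos.ne'
  have hd : (d : ℂ) ≠ 0 := by exact_mod_cast h.right_pos.ne'
  obtain ⟨z, hz⟩ := exists_thetaWedge_ne_zero (affinePoint h.left_pos h.right_pos b τ)
  have h1 := jacobiSlash_vadd hφ g τ (z / a)
  have e : (affinePoint h.left_pos h.right_pos b (((m * N : ℕ) : ℝ) +ᵥ τ) : ℂ) =
      affinePoint h.left_pos h.right_pos b τ + (a ^ 2 * N : ℕ) := by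
    rw [coe_affinePoint, coe_affinePoint, coe_vadd, ← h.mul_eq]
    push_cast
    field_simp
    ring
  have e' := thetaWedge_add_intCast (a ^ 2 * N : ℕ) (affinePoint h.left_pos h.right_pos b τ) z
  rw [Int.cast_natCast] at e'
  rw [h.jacobiSlash_starForm, h.jacobiSlash_starForm, mul_div_cancel₀ z ha, e, e'] at h1
  have hdet : (thetaMultiplier 1 g').det / (d : ℂ) ≠ 0 := by
    refine div_ne_zero (norm_pos_iff.1 ?_) hd
    rw [norm_det_thetaMultiplier]
    exact one_pos
  refine mul_left_cancel₀ hdet (mul_right_cancel₀ hz ?_)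
  linear_combination h1

lemma hasSum_mul_prod {ι κ : Type*} {A : ι → ℂ} {B : κ → ℂ} {x y : ℂ} (hA : HasSum A x)
    (hB : HasSum B y) : HasSum (fun p : ι × κ ↦ A p.1 * B p.2) (x * y) :=
  hA.mul hB (summable_mul_of_summable_norm hA.summable.norm hB.summable.norm)

lemma hasSum_thetaJ_one_zero {τ : ℂ} (hτ : 0 < τ.im) (z : ℂ) :
    HasSum (fun n : ℤ ↦ cexp (2 * π * I * ((n ^ 2 : ℤ) * τ + (2 * n : ℤ) * z)))
      (thetaJ 1 0 τ z) := by
  refine (hasSum_thetaJ one_ne_zero 0 hτ z).congr_fun fun n ↦ ?_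
  push_cast
  ring_nf

lemma hasSum_thetaJ_one_one {τ : ℂ} (hτ : 0 < τ.im) (z : ℂ) :
    HasSum (fun n : ℤ ↦ cexp (2 * π * I * ((n ^ 2 + n : ℤ) * τ + (2 * n + 1 : ℤ) * z)))
      (cexp (-(2 * π * I * (τ / 4))) * thetaJ 1 1 τ z) := by
  refine ((hasSum_thetaJ one_ne_zero 1 hτ z).mul_left _).congr_fun fun n ↦ ?_
  rw [← Complex.exp_add]
  push_cast
  ring_nf

/-- With `t = a²N`, the bounds `t ≤ 4n` and `ρ² ≤ 4κ + 1` combine to `tρ² ≤ 4(n + κt)`, which is the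
Jacobi condition divided by `m`. The deficit `+1` of the theta side is exactly paid by the lower
bound on `n`. -/
lemma hasJacobiExpansion_mul (hm : m ≠ 0) (hN : N ≠ 0) (ha : 0 < a) (hd : 0 < d) (had : a * d = m)
    {G : ℍ → ℂ} {n : ℕ → ℕ} {c : ℕ → ℂ} (hc : ∀ j, c j ≠ 0 → a ^ 2 * N ≤ 4 * n j)
    (hG : ∀ τ : ℍ, HasSum (fun j ↦ c j * cexp (2 * π * I * (n j * τ / (m * N : ℕ)))) (G τ))
    {Q : ℂ → ℂ → ℂ} {κ ρ : ℤ × ℤ → ℤ} (hκ : ∀ p, ρ p ^ 2 ≤ 4 * κ p + 1)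
    (hQ : ∀ (w : ℂ), 0 < w.im → ∀ z : ℂ,
      HasSum (fun p ↦ cexp (2 * π * I * (κ p * w + ρ p * z))) (Q w z)) :
    HasJacobiExpansion m (m * N) fun τ z ↦ G τ * Q (affinePoint ha hd b τ) (a * z) := by
  have hNC : (N : ℂ) ≠ 0 := mod_cast hN
  have hdC : (d : ℂ) ≠ 0 := mod_cast hd.ne'
  have haC : (a : ℂ) ≠ 0 := mod_cast ha.ne'
  have hmC' : (m : ℂ) = a * d := by exact_mod_cast had.symm
  refine hasJacobiExpansion_of_hasSum
    (fun p : ℕ × (ℤ × ℤ) ↦ c p.1 * cexp (2 * π * I * (κ p.2 * b / d)))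
    (fun p ↦ n p.1 + κ p.2 * (a ^ 2 * N : ℕ)) (fun p ↦ a * ρ p.2) (fun p hp ↦ ?_) fun τ z ↦ ?_
  · have h1 : ((a ^ 2 * N : ℕ) : ℤ) ≤ 4 * n p.1 := by
      exact_mod_cast hc p.1 (left_ne_zero_of_mul hp)
    have h2 := hκ p.2
    have h3 : (0 : ℤ) ≤ (a ^ 2 * N : ℕ) := by positivity
    have h4 : (0 : ℤ) ≤ m := by positivity
    have h5 : ((m * N : ℕ) : ℤ) * (a * ρ p.2) ^ 2 = m * ((a ^ 2 * N : ℕ) * ρ p.2 ^ 2) := by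
      push_cast
      ring
    rw [h5, mul_comm 4 (m : ℤ), mul_assoc]
    refine mul_le_mul_of_nonneg_left ?_ h4
    nlinarith [mul_le_mul_of_nonneg_left h2 h3]
  · have h1 := hG τ
    have h2 := hQ _ (affinePoint ha hd b τ).im_pos (a * z)
    refine (hasSum_mul_prod h1 h2).congr_fun fun p ↦ ?_
    rw [mul_assoc (c p.1), mul_assoc (c p.1), ← Complex.exp_add, ← Complex.exp_add, coe_affinePoint]
    congr 2
    push_cast
    rw [hmC']
    field_simp
    ring

lemma IsScaleFactorization.hasJacobiExpansion_starForm (h : IsScaleFactorization m g g' a d b)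
    (hm : m ≠ 0) (hN : N ≠ 0) {k : ℤ} (hf : f ∈ modularForms (k - 1) (m * N)
      (twistedNebentypus m χ)) :
    HasJacobiExpansion m (m * N) (jacobiSlash k m g (starForm m f)) := by
  have hφ (γ : Gamma0 (m * N)) (τ : ℍ) := (starForm_transform_iff hm k γ τ).2 (hf.2.1 γ τ)
  have hNC : (N : ℂ) ≠ 0 := mod_cast hN
  have hdC : (d : ℂ) ≠ 0 := mod_cast h.right_pos.ne'
  have haC : (a : ℂ) ≠ 0 := mod_cast h.left_pos.ne'
  have hmC' : (m : ℂ) = a * d := by exact_mod_cast h.mul_eq.symm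
  obtain ⟨n, c, hc, hG⟩ := exists_hasSum_of_isBoundedAtImInfty (mul_ne_zero hm hN)
    (f := f ∣[(k - 1)] g) (hf.1.slash (k - 1) _) (hf.2.2 g) (h.slash_vadd_mul hφ)
  have h1 := hasJacobiExpansion_mul (b := b) hm hN h.left_pos h.right_pos h.mul_eq hc hG
    (Q := fun w z ↦ thetaJ 1 0 w z * (cexp (-(2 * π * I * (w / 4))) * thetaJ 1 1 w 0))
    (κ := fun p ↦ p.1 ^ 2 + (p.2 ^ 2 + p.2)) (ρ := fun p ↦ 2 * p.1)
    (fun p ↦ by nlinarith [sq_nonneg (2 * p.2 + 1)]) fun w hw z ↦ by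
      refine (hasSum_mul_prod (hasSum_thetaJ_one_zero hw z)
        (hasSum_thetaJ_one_one hw 0)).congr_fun fun p ↦ ?_
      rw [← Complex.exp_add]
      push_cast
      ring_nf
  have h2 := hasJacobiExpansion_mul (b := b) hm hN h.left_pos h.right_pos h.mul_eq hc hG
    (Q := fun w z ↦ thetaJ 1 0 w 0 * (cexp (-(2 * π * I * (w / 4))) * thetaJ 1 1 w z))
    (κ := fun p ↦ p.1 ^ 2 + (p.2 ^ 2 + p.2)) (ρ := fun p ↦ 2 * p.2 + 1)
    (fun p ↦ by nlinarith [sq_nonneg p.1]) fun w hw z ↦ by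
      refine (hasSum_mul_prod (hasSum_thetaJ_one_zero hw 0)
        (hasSum_thetaJ_one_one hw z)).congr_fun fun p ↦ ?_
      rw [← Complex.exp_add]
      push_cast
      ring_nf
  have h3 := (h1.sub h2).const_smul
    ((thetaMultiplier 1 g').det / d * cexp (2 * π * I * (b / (4 * d))))
  convert h3 using 1
  ext τ z
  rw [h.jacobiSlash_starForm]
  -- The fractional factor `e^{2πiw/4}` of `θ_{1,1}` has been moved to `f ∣[k-1] g`, leaving
  -- integral exponents in both factors. As `a²N/(4mN) = a/(4d)`, the two shifts agree up to the
  -- constant `e^{2πi b/4d}`.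
  have e : cexp (2 * π * I * ((a ^ 2 * N : ℕ) * τ / (4 * (m * N : ℕ)))) *
      cexp (-(2 * π * I * (affinePoint h.left_pos h.right_pos b τ / 4))) *
        cexp (2 * π * I * (b / (4 * d))) = 1 := by
    rw [← Complex.exp_add, ← Complex.exp_add, ← Complex.exp_zero]
    congr 1
    rw [coe_affinePoint]
    push_cast
    rw [hmC']
    field_simp
    ring
  simp only [Pi.smul_apply, Pi.sub_apply, smul_eq_mul, thetaWedge, theta]
  linear_combination (-((thetaMultiplier 1 g').det / d * (f ∣[(k - 1)] g) τ *
    (thetaJ 1 1 (affinePoint h.left_pos h.right_pos b τ) 0 *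
      thetaJ 1 0 (affinePoint h.left_pos h.right_pos b τ) (a * z) -
    thetaJ 1 0 (affinePoint h.left_pos h.right_pos b τ) 0 *
      thetaJ 1 1 (affinePoint h.left_pos h.right_pos b τ) (a * z)))) * e

lemma isJointlyHolomorphic_starForm (hm : m ≠ 0) (hf : MDiff f) :
    IsJointlyHolomorphic (starForm m f) := by
  have hf' := UpperHalfPlane.mdifferentiable_iff.1 hf
  have h0 : DifferentiableOn ℂ (fun p : ℂ × ℂ ↦ f (ofComplex p.1)) {p | 0 < p.1.im} :=
    hf'.comp (f := fun p : ℂ × ℂ ↦ p.1) (by fun_prop) fun p hp ↦ hp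
  have hθ (r : ℕ) := differentiableOn_thetaJ hm r
  have hθ0 (r : ℕ) : DifferentiableOn ℂ (fun p : ℂ × ℂ ↦ theta m r p.1) {p | 0 < p.1.im} :=
    (hθ r).comp (f := fun p : ℂ × ℂ ↦ (p.1, (0 : ℂ))) (by fun_prop) fun p hp ↦ hp
  refine (h0.mul (((hθ0 m).mul (hθ 0)).sub ((hθ0 0).mul (hθ m)))).congr fun p hp ↦ ?_
  simp [starForm, thetaWedge_mul m hm, ofComplex_apply_of_im_pos hp]

lemma starForm_add_lattice (hm : m ≠ 0) (l μ : ℤ) (τ : ℍ) (z : ℂ) :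
    starForm m f τ (z + l * τ + μ) =
      cexp (-(2 * π * I * m * ((l : ℂ) ^ 2 * τ + 2 * l * z))) * starForm m f τ z := by
  simp only [starForm, thetaWedge_mul m hm, thetaJ_add_lattice hm]
  ring

theorem starForm_mem_jacobiStarKernel (hm : m ≠ 0) (hN : N ≠ 0) {k : ℤ}
    (hf : f ∈ modularForms (k - 1) (m * N) (twistedNebentypus m χ)) :
    starForm m f ∈ jacobiStarKernel k m N χ := by
  refine ⟨⟨isJointlyHolomorphic_starForm hm hf.1,
    fun γ τ ↦ (starForm_transform_iff hm k γ τ).2 (hf.2.1 γ τ), starForm_add_lattice hm,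
    fun g ↦ ?_⟩, ⟨_, isThetaDecomposition_starForm hm f, fun r _ h0 h1 ↦ ?_⟩, starForm_zero m f⟩
  · obtain ⟨g', a, d, b, h⟩ := exists_isScaleFactorization hm g
    exact h.hasJacobiExpansion_starForm hm hN hf
  · ext τ
    simp [h0, h1]

end

/-! ### The isomorphisms -/

section

variable {k m N : ℕ}

/-- The operator `D₂` as a linear map from Jacobi forms to cusp forms. -/
def D₂Linear (k : ℕ) {m M : ℕ} (hm : m ≠ 0) (hM : M ≠ 0) (χ : DirichletCharacter ℂ M) :
    jacobiForms k m M χ →ₗ[ℂ] cuspForms (k + 2) M (nebentypus χ) where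
  toFun φ := ⟨D₂ k m φ, D₂_mem_cuspForms hm hM φ.2⟩
  map_add' φ ψ := Subtype.ext (heatOperator_add k (2 * m) φ.2.1 ψ.2.1)
  map_smul' c φ := Subtype.ext (heatOperator_smul k (2 * m) c φ)

/-- Multiplication by `θ_{m,m} θ^J_{m,0} - θ_{m,0} θ^J_{m,m}` as a linear map. -/
def starFormLinear (k : ℕ) (hm : m ≠ 0) (hN : N ≠ 0) (χ : DirichletCharacter ℂ (m * N)) :
    modularForms (k - 1) (m * N) (twistedNebentypus m χ) →ₗ[ℂ] jacobiStarKernel k m N χ where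
  toFun f := ⟨starForm m f, starForm_mem_jacobiStarKernel hm hN f.2⟩
  map_add' _ _ := Subtype.ext <| funext₂ fun _ _ ↦ add_mul _ _ _
  map_smul' _ _ := Subtype.ext <| funext₂ fun _ _ ↦ mul_assoc _ _ _

lemma starFormLinear_bijective (hk : k ≠ 0) (hm : m ≠ 0) (hN : N ≠ 0)
    (χ : DirichletCharacter ℂ (m * N)) : Function.Bijective (starFormLinear k hm hN χ) := by
  refine ⟨fun f g h ↦ Subtype.ext (starForm_injective hm (congrArg Subtype.val h)), fun φ ↦ ?_⟩
  obtain ⟨f, hf⟩ := exists_eq_starForm hm φ.2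
  exact ⟨⟨f, mem_modularForms_of_starForm_mem hk hm hN (hf ▸ φ.2.1)⟩, Subtype.ext hf.symm⟩

/-- Multiplication by `θ_{m,m} θ^J_{m,0} - θ_{m,0} θ^J_{m,m}` as a linear isomorphism. -/
def starFormEquiv (hk : k ≠ 0) (hm : m ≠ 0) (hN : N ≠ 0) (χ : DirichletCharacter ℂ (m * N)) :
    modularForms (k - 1) (m * N) (twistedNebentypus m χ) ≃ₗ[ℂ] jacobiStarKernel k m N χ :=
  LinearEquiv.ofBijective (starFormLinear k hm hN χ) (starFormLinear_bijective hk hm hN χ)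

lemma mul_xiStar_mul_mem_cuspStar (hm : m ≠ 0) (hN : N ≠ 0) {χ : DirichletCharacter ℂ (m * N)}
    {f : ℍ → ℂ} (hf : f ∈ modularForms (k - 1) (m * N) (twistedNebentypus m χ)) :
    (fun τ ↦ 4 * m * k * xiStar m τ * f τ) ∈ cuspStar k m N χ := by
  refine ⟨?_, ?_⟩
  · have h := D₂_mem_cuspForms hm (mul_ne_zero hm hN) (starForm_mem_jacobiStarKernel hm hN hf).1
    rwa [funext (D₂_starForm k hm f)] at h
  · convert Submodule.smul_mem _ (4 * m * k : ℂ) hf using 1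
    ext τ
    have := xiStar_ne_zero hm τ
    simp only [Pi.div_apply, Pi.smul_apply, smul_eq_mul]
    field_simp

/-- Multiplication by `4 m k ξ*_m` as a linear isomorphism. -/
def mulXiStarEquiv (hk : k ≠ 0) (hm : m ≠ 0) (hN : N ≠ 0) (χ : DirichletCharacter ℂ (m * N)) :
    modularForms (k - 1) (m * N) (twistedNebentypus m χ) ≃ₗ[ℂ] cuspStar k m N χ where
  toFun f := ⟨_, mul_xiStar_mul_mem_cuspStar hm hN f.2⟩
  invFun g := ⟨(4 * m * k : ℂ)⁻¹ • ((g : ℍ → ℂ) / xiStar m), Submodule.smul_mem _ _ g.2.2⟩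
  map_add' f g := Subtype.ext <| funext fun τ ↦ mul_add _ _ _
  map_smul' c f := Subtype.ext <| funext fun τ ↦ mul_left_comm _ _ _
  left_inv f := by
    ext τ
    have := xiStar_ne_zero hm τ
    have hk' : (k : ℂ) ≠ 0 := mod_cast hk
    have hm' : (m : ℂ) ≠ 0 := mod_cast hm
    simp only [Pi.div_apply, Pi.smul_apply, smul_eq_mul]
    field_simp
  right_inv g := by
    ext τ
    have := xiStar_ne_zero hm τ
    have hk' : (k : ℂ) ≠ 0 := mod_cast hk
    have hm' : (m : ℂ) ≠ 0 := mod_cast hm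
    simp only [Pi.div_apply, Pi.smul_apply, smul_eq_mul]
    field_simp

end

end JacobiRestriction

end

theorem theorem4p2 (k m N : ℕ) (hk : 0 < k) (hm : Squarefree m) (hN : 0 < N)
    (χ : DirichletCharacter ℂ (m * N)) :
    (∀ τ : ℍ, xiStar m τ = -(π * I * m * ModularForm.eta (m * (τ : ℂ)) ^ 6)) ∧
    (∃ D : jacobiForms k m (m * N) χ →ₗ[ℂ] cuspForms (k + 2) (m * N) (nebentypus χ),
      ∀ φ, (D φ : ℍ → ℂ) = D₂ k m φ) ∧
    (∀ φ ∈ jacobiStarKernel k m N χ, ∀ a : ℂ, heatOperator k a φ = D₂ k m φ) ∧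
    ∃ (Λ : jacobiStarKernel k m N χ ≃ₗ[ℂ]
          modularForms (k - 1) (m * N) (twistedNebentypus m χ))
      (E : jacobiStarKernel k m N χ ≃ₗ[ℂ] cuspStar k m N χ)
      (B : modularForms (k - 1) (m * N) (twistedNebentypus m χ) ≃ₗ[ℂ] cuspStar k m N χ),
      (∀ φ, (E φ : ℍ → ℂ) = D₂ k m φ) ∧
      (∀ (φ : jacobiStarKernel k m N χ) (h : ℕ → ℍ → ℂ), IsThetaDecomposition m φ h →
        ∀ τ : ℍ, (Λ φ : ℍ → ℂ) τ = h 0 τ / theta m m τ ∧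
          (Λ φ : ℍ → ℂ) τ = -h m τ / theta m 0 τ) ∧
      (∀ (f : modularForms (k - 1) (m * N) (twistedNebentypus m χ)) (τ : ℍ),
        (B f : ℍ → ℂ) τ = 4 * m * k * xiStar m τ * (f : ℍ → ℂ) τ) ∧
      ∀ φ, B (Λ φ) = E φ := by
  have hm0 := hm.ne_zero
  -- `Λ` inverts `f ↦ starForm m f` and `E` is the composite of `Λ` with `B`, so `B (Λ φ) = E φ`
  -- holds by definition. What remains is to identify `E` with `D₂` and `Λ` with the two quotients,
  -- which is checked on `φ = starForm m f` using uniqueness of the theta components.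
  refine ⟨xiStar_eq hm0, ⟨D₂Linear k hm0 (mul_ne_zero hm0 hN.ne') χ, fun φ ↦ rfl⟩,
    fun φ hφ a ↦ ?_, (starFormEquiv hk.ne' hm0 hN.ne' χ).symm,
    (starFormEquiv hk.ne' hm0 hN.ne' χ).symm.trans (mulXiStarEquiv hk.ne' hm0 hN.ne' χ),
    mulXiStarEquiv hk.ne' hm0 hN.ne' χ, fun φ ↦ ?_, fun φ h hd τ ↦ ?_, fun f τ ↦ rfl, fun φ ↦ rfl⟩
  · ext τ
    rw [D₂, heatOperator_of_apply_zero _ _ hφ.2.2, heatOperator_of_apply_zero _ _ hφ.2.2]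
  · obtain ⟨f, rfl⟩ := (starFormEquiv hk.ne' hm0 hN.ne' χ).surjective φ
    rw [LinearEquiv.trans_apply, LinearEquiv.symm_apply_apply]
    exact (funext (D₂_starForm k hm0 (f : ℍ → ℂ))).symm
  · obtain ⟨f, rfl⟩ := (starFormEquiv hk.ne' hm0 hN.ne' χ).surjective φ
    rw [LinearEquiv.symm_apply_apply]
    have hs := isThetaDecomposition_starForm hm0 (f : ℍ → ℂ)
    have h0 := hd.eq hm0 hs (j := 0) (by omega)
    have h1 := hd.eq hm0 hs (j := m) (by omega)
    rw [h0, h1]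
    simp [hm0, theta_self_ne_zero hm0, theta_zero_ne_zero hm0]
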